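/- Let $S$ be a scheme, let $G$ be a group scheme over $S$ with multiplication $m\colon G\times_S G\to G$, and let $F$ be a sheaf of Abelian groups (written multiplicatively) on the big fppf site $S_{\mathrm{fppf}}$. Assume that $F$ is representable by a scheme that is fppf and affine over $S$. For an $S$-scheme $X$ write $F_X$ for the trivial $F$-torsor on $X$; for $F$-torsors write $T\otimes T'$ for the contracted product and $T^\vee$ for the dual (the same sheaf with the inverse action of $F$). Write $p_0,p_1\colon G^2\to G$ for the projections, and $p_{0,1}=\mathrm{id}\times p_0$, $p_{1,2}=p_1\times\mathrm{id}$, $m_{0,1}=m\times\mathrm{id}$, $m_{1,2}=\mathrm{id}\times m$ for the indicated morphisms $G^3\to G^2$. For an $F$-torsor $T$ on $G$ and an $F$-torsor $P$ on $G^2$ put \[ \delta^1T=p_1^*T\otimes(m^*T)^\vee\otimes p_0^*T,\qquad \delta^2P=p_{1,2}^*P\otimes(m_{0,1}^*P)^\vee\otimes m_{1,2}^*P\otimes(p_{0,1}^*P)^\vee . \] Let $\kappa_T\colon F_{G^3}\xrightarrow{\sim}\delta^2\delta^1T$ be the canonical trivialisation: over a point $(a,b,c)$ of $G^3$ it sends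 $1$ to \[ (t_c\otimes t_{bc}^\vee\otimes t_b)\otimes(t_c\otimes t_{abc}^\vee\otimes t_{ab})^\vee\otimes(t_{bc}\otimes t_{abc}^\vee\otimes t_a)\otimes(t_b\otimes t_{ab}^\vee\otimes t_a)^\vee \] for arbitrary local sections $t_g$ of $T$ over the points $g\in\{a,b,c,ab,bc,abc\}$ of $G$ (this does not depend on their choice). An $F$-extension datum on $G$ is a pair $(T,\tau)$ where $T$ is an $F$-torsor on $G$ and $\tau\colon F_{G^2}\xrightarrow{\sim}\delta^1T$ is an isomorphism of $F$-torsors on $G^2$ such that the composition of the canonical isomorphism $F_{G^3}\xrightarrow{\sim}\delta^2F_{G^2}$ with $\delta^2\tau$ equals $\kappa_T$. An isomorphism $(T,\tau)\to(T',\tau')$ is an isomorphism $\phi\colon T\xrightarrow{\sim}T'$ of $F$-torsors with $\delta^1\phi\circ\tau=\tau'$. Let $\mathcal E(G,F)$ be the groupoid of $F$-extension data on $G$. A central extension of $G$ by $F$ is an exact sequence $1\to F\xrightarrow{j}E\xrightarrow{q}G\to1$ of sheaves of groups on $S_{\mathrm{fppf}}$ with $j(F)$ central in $E$; morphisms of central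 extensions are the homomorphisms $E\to E'$ compatible with $j$ and $q$. Then there is a canonical equivalence of categories between $\mathcal E(G,F)$ and the category of central extensions of $G$ by $F$. More precisely, there is an equivalence under which, naturally in $(T,\tau)$, the extension $E$ corresponding to $(T,\tau)$ is identified with $T$ as an $F$-torsor on $G$ (where $F$ acts on $E$ through multiplication by $j$ and $E$ lies over $G$ via $q$), in such a way that $\tau$ is the trivialisation defined by the group law of $E$: for all sections $x,y$ of $E$ over an $S$-scheme $U$, $\tau$ sends $1$ over the point $(q(x),q(y))$ of $G^2$ to $y\otimes(xy)^\vee\otimes x$. -/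

import Mathlib

universe w u

open CategoryTheory Opposite MonoidalCategory CartesianMonoidalCategory MonObj

noncomputable section

namespace ExtData

section Presheaf

variable {C : Type (u + 1)} [Category.{u} C] {J : GrothendieckTopology C}

theorem presheaf_map_id (P : Cᵒᵖ ⥤ Type w) {U : C} (t : P.obj (op U)) :
    P.map (𝟙 U).op t = t := by
  simp

theorem presheaf_map_map (P : Cᵒᵖ ⥤ Type w) {U V W : C} (g : V ⟶ U) (h : W ⟶ V)
    (t : P.obj (op U)) : P.map h.op (P.map g.op t) = P.map (h ≫ g).op t := by
  simp

theorem sheaf_sep {P : Cᵒᵖ ⥤ Type w} (hP : Presheaf.IsSheaf J P) {U : C} {R : Sieve U}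
    (hR : R ∈ J U) {x y : P.obj (op U)}
    (h : ∀ ⦃V : C⦄ (g : V ⟶ U), R g → P.map g.op x = P.map g.op y) : x = y :=
  (hP.isSheafFor R hR).isSeparatedFor.ext fun _ g hg => h g hg

/-- Gluing sections that are characterised by a property: a property of sections of a sheaf over
objects over `U` that is stable under restriction, has at most one solution over each object, and
has a solution locally, comes from a section over `U`. -/
theorem sheaf_glue {P : Cᵒᵖ ⥤ Type w} (hP : Presheaf.IsSheaf J P) {U : C} {R : Sieve U}
    (hR : R ∈ J U) (p : ∀ ⦃V : C⦄ (_ : V ⟶ U), P.obj (op V) → Prop)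
    (hres : ∀ ⦃V W : C⦄ (g : V ⟶ U) (h : W ⟶ V) (t : P.obj (op V)),
      p g t → p (h ≫ g) (P.map h.op t))
    (huniq : ∀ ⦃V : C⦄ (g : V ⟶ U) (t t' : P.obj (op V)), R g → p g t → p g t' → t = t')
    (hex : ∀ ⦃V : C⦄ (g : V ⟶ U), R g → ∃ t, p g t) :
    ∃ t : P.obj (op U), ∀ ⦃V : C⦄ (g : V ⟶ U), R g → p g (P.map g.op t) := by
  choose x hx using hex
  have hc : Presieve.FamilyOfElements.SieveCompatible (P := P) (S := R) (fun V g hg => x g hg) := by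
    intro V W g h hg
    exact huniq _ _ _ (R.downward_closed hg h) (hx _ _) (hres _ _ _ (hx _ _))
  obtain ⟨t, ht, -⟩ := hP.isSheafFor R hR _ ((Presieve.compatible_iff_sieveCompatible _).2 hc)
  refine ⟨t, fun V g hg => ?_⟩
  rw [ht g hg]
  exact hx g hg

theorem isSheaf_of_sep_glue {P : Cᵒᵖ ⥤ Type w}
    (sep : ∀ ⦃U : C⦄ (R : Sieve U), R ∈ J U → ∀ x y : P.obj (op U),
      (∀ ⦃V : C⦄ (g : V ⟶ U), R g → P.map g.op x = P.map g.op y) → x = y)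
    (glue : ∀ ⦃U : C⦄ (R : Sieve U), R ∈ J U → ∀ x : (∀ ⦃V : C⦄ (g : V ⟶ U), R g → P.obj (op V)),
      (∀ ⦃V W : C⦄ (g : V ⟶ U) (h : W ⟶ V) (hg : R g),
        x (h ≫ g) (R.downward_closed hg h) = P.map h.op (x g hg)) →
      ∃ t : P.obj (op U), ∀ ⦃V : C⦄ (g : V ⟶ U) (hg : R g), P.map g.op t = x g hg) :
    Presheaf.IsSheaf J P := by
  rw [isSheaf_iff_isSheaf_of_type]
  intro U R hR x hx
  rw [Presieve.compatible_iff_sieveCompatible] at hx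
  obtain ⟨t, ht⟩ := glue R hR (fun V g hg => x g hg) (fun V W g h hg => hx g h hg)
  refine ⟨t, fun V g hg => ht g hg, fun y hy => sep R hR _ _ fun V g hg => ?_⟩
  rw [ht g hg]
  exact hy g hg

theorem sheaf_glue_family {P : Cᵒᵖ ⥤ Type w} (hP : Presheaf.IsSheaf J P) {U : C} {R : Sieve U}
    (hR : R ∈ J U) (x : ∀ ⦃V : C⦄ (g : V ⟶ U), R g → P.obj (op V))
    (hx : ∀ ⦃V W : C⦄ (g : V ⟶ U) (h : W ⟶ V) (hg : R g),
        x (h ≫ g) (R.downward_closed hg h) = P.map h.op (x g hg)) :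
    ∃ t : P.obj (op U), ∀ ⦃V : C⦄ (g : V ⟶ U) (hg : R g), P.map g.op t = x g hg := by
  obtain ⟨t, ht, -⟩ := hP.isSheafFor R hR (fun V g hg => x g hg)
    ((Presieve.compatible_iff_sieveCompatible _).2 (fun V W g h hg => hx g h hg))
  exact ⟨t, fun V g hg => ht g hg⟩

theorem isSheaf_yoneda [J.Subcanonical] (X : C) : Presheaf.IsSheaf J (yoneda.obj X) :=
  (isSheaf_iff_isSheaf_of_type _ _).2
    (GrothendieckTopology.Subcanonical.isSheaf_of_isRepresentable _)

end Presheaf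

variable {C : Type (u + 1)} [Category.{u} C] {J : GrothendieckTopology C}

/-- The sheaf of sets underlying a sheaf of abelian groups. -/
abbrev underlying (F : Sheaf J CommGrpCat.{u + 1}) : Sheaf J (Type (u + 1)) :=
  (sheafCompose J (forget CommGrpCat.{u + 1})).obj F

/-- An `F`-torsor over an object `X` of the site: a sheaf over `X` (the total space of the sheaf on
the localised site over `X`; a section over `p : U ⟶ X` is an element of `sheaf U` lying over `p`)
with an action of `F` that is simply transitive on the fibres, having sections locally on `X`. -/
structure Torsor (F : Sheaf J CommGrpCat.{u + 1}) (X : C) where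
  sheaf : Sheaf J (Type (u + 1))
  proj : ∀ {U : C}, sheaf.obj.obj (op U) → (U ⟶ X)
  smul : ∀ {U : C}, F.obj.obj (op U) → sheaf.obj.obj (op U) → sheaf.obj.obj (op U)
  proj_map : ∀ {U V : C} (g : V ⟶ U) (t : sheaf.obj.obj (op U)),
    proj (sheaf.obj.map g.op t) = g ≫ proj t
  smul_map : ∀ {U V : C} (g : V ⟶ U) (f : F.obj.obj (op U)) (t : sheaf.obj.obj (op U)),
    sheaf.obj.map g.op (smul f t) = smul (F.obj.map g.op f) (sheaf.obj.map g.op t)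
  proj_smul : ∀ {U : C} (f : F.obj.obj (op U)) (t : sheaf.obj.obj (op U)),
    proj (smul f t) = proj t
  one_smul : ∀ {U : C} (t : sheaf.obj.obj (op U)), smul 1 t = t
  mul_smul : ∀ {U : C} (f f' : F.obj.obj (op U)) (t : sheaf.obj.obj (op U)),
    smul (f * f') t = smul f (smul f' t)
  simply_transitive : ∀ {U : C} (t t' : sheaf.obj.obj (op U)), proj t = proj t' →
    ∃! f : F.obj.obj (op U), smul f t = t'
  locally_nonempty : ∀ {U : C} (x : U ⟶ X), ∃ R ∈ J U, ∀ ⦃V : C⦄ (g : V ⟶ U), R g →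
    ∃ t : sheaf.obj.obj (op V), proj t = g ≫ x

namespace Torsor

variable {F : Sheaf J CommGrpCat.{u + 1}} {X Y : C}

/-- Sections over `U` of the total space of a torsor. -/
def sec (T : Torsor F X) (U : C) : Type (u + 1) := T.sheaf.obj.obj (op U)

/-- The point of `X` over which a section lies. -/
def pr (T : Torsor F X) {U : C} (t : T.sec U) : U ⟶ X := T.proj t

/-- Restriction of sections. -/
def res (T : Torsor F X) {U V : C} (g : V ⟶ U) (t : T.sec U) : T.sec V := T.sheaf.obj.map g.op t

instance (T : Torsor F X) (U : C) : MulAction (F.obj.obj (op U)) (T.sec U) where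
  smul := T.smul
  one_smul := T.one_smul
  mul_smul := T.mul_smul

section
variable (T : Torsor F X) {U V W : C}

@[simp] theorem res_id (t : T.sec U) : T.res (𝟙 U) t = t :=
  presheaf_map_id T.sheaf.obj t

theorem res_res (g : V ⟶ U) (h : W ⟶ V) (t : T.sec U) :
    T.res h (T.res g t) = T.res (h ≫ g) t :=
  presheaf_map_map T.sheaf.obj g h t

@[simp] theorem pr_res (g : V ⟶ U) (t : T.sec U) : T.pr (T.res g t) = g ≫ T.pr t :=
  T.proj_map g t

@[simp] theorem pr_smul (f : F.obj.obj (op U)) (t : T.sec U) : T.pr (f • t) = T.pr t :=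
  T.proj_smul f t

theorem res_smul (g : V ⟶ U) (f : F.obj.obj (op U)) (t : T.sec U) :
    T.res g (f • t) = (F.obj.map g.op f : F.obj.obj (op V)) • T.res g t :=
  T.smul_map g f t

theorem exists_smul {t t' : T.sec U} (h : T.pr t = T.pr t') :
    ∃ f : F.obj.obj (op U), f • t = t' := (T.simply_transitive t t' h).exists

theorem smul_inj {t : T.sec U} {f f' : F.obj.obj (op U)} (h : f • t = f' • t) : f = f' :=
  (T.simply_transitive t (f' • t) (T.pr_smul f' t).symm).unique h rfl

theorem sep {R : Sieve U} (hR : R ∈ J U) {x y : T.sec U}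
    (h : ∀ ⦃V : C⦄ (g : V ⟶ U), R g → T.res g x = T.res g y) : x = y :=
  sheaf_sep T.sheaf.property hR h

theorem glue {R : Sieve U} (hR : R ∈ J U) (p : ∀ ⦃V : C⦄ (_ : V ⟶ U), T.sec V → Prop)
    (hres : ∀ ⦃V W : C⦄ (g : V ⟶ U) (h : W ⟶ V) (t : T.sec V), p g t → p (h ≫ g) (T.res h t))
    (huniq : ∀ ⦃V : C⦄ (g : V ⟶ U) (t t' : T.sec V), R g → p g t → p g t' → t = t')
    (hex : ∀ ⦃V : C⦄ (g : V ⟶ U), R g → ∃ t, p g t) :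
    ∃ t : T.sec U, ∀ ⦃V : C⦄ (g : V ⟶ U), R g → p g (T.res g t) :=
  sheaf_glue T.sheaf.property hR p hres huniq hex

theorem glue_family {R : Sieve U} (hR : R ∈ J U) (x : ∀ ⦃V : C⦄ (g : V ⟶ U), R g → T.sec V)
    (hx : ∀ ⦃V W : C⦄ (g : V ⟶ U) (h : W ⟶ V) (hg : R g),
        x (h ≫ g) (R.downward_closed hg h) = T.res h (x g hg)) :
    ∃ t : T.sec U, ∀ ⦃V : C⦄ (g : V ⟶ U) (hg : R g), T.res g t = x g hg :=
  sheaf_glue_family T.sheaf.property hR x hx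

theorem local_sec (x : U ⟶ X) : ∃ R ∈ J U, ∀ ⦃V : C⦄ (g : V ⟶ U), R g →
    ∃ t : T.sec V, T.pr t = g ≫ x := T.locally_nonempty x

end

/-- Morphisms of `F`-torsors over `X`: `F`-equivariant morphisms of sheaves over `X`. -/
@[ext] structure Hom (T T' : Torsor F X) where
  hom : T.sheaf ⟶ T'.sheaf
  proj_hom : ∀ {U : C} (t : T.sheaf.obj.obj (op U)), T'.proj (hom.hom.app (op U) t) = T.proj t
  smul_hom : ∀ {U : C} (f : F.obj.obj (op U)) (t : T.sheaf.obj.obj (op U)),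
    hom.hom.app (op U) (T.smul f t) = T'.smul f (hom.hom.app (op U) t)

instance : Category (Torsor F X) where
  Hom := Hom
  id T := ⟨𝟙 _, fun _ => rfl, fun _ _ => rfl⟩
  comp φ ψ := ⟨φ.hom ≫ ψ.hom,
    fun t => (ψ.proj_hom _).trans (φ.proj_hom t),
    fun f t => (congrArg _ (φ.smul_hom f t)).trans (ψ.smul_hom f _)⟩

/-- The action of a morphism of torsors on sections. -/
def app {T T' : Torsor F X} (φ : T ⟶ T') {U : C} (t : T.sec U) : T'.sec U :=
  (Hom.hom φ).hom.app (op U) t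

section
variable {T T' T'' : Torsor F X} {U V : C}

@[simp] theorem app_id (t : T.sec U) : app (𝟙 T) t = t := rfl

@[simp] theorem app_comp (φ : T ⟶ T') (ψ : T' ⟶ T'') (t : T.sec U) :
    app (φ ≫ ψ) t = app ψ (app φ t) := rfl

@[simp] theorem pr_app (φ : T ⟶ T') (t : T.sec U) : T'.pr (app φ t) = T.pr t :=
  Hom.proj_hom φ t

@[simp] theorem app_smul (φ : T ⟶ T') (f : F.obj.obj (op U)) (t : T.sec U) :
    app φ (f • t) = f • app φ t := Hom.smul_hom φ f t

theorem res_app (φ : T ⟶ T') (g : V ⟶ U) (t : T.sec U) :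
    T'.res g (app φ t) = app φ (T.res g t) :=
  (NatTrans.naturality_apply (Hom.hom φ).hom g.op t).symm

theorem hom_ext {φ ψ : T ⟶ T'} (h : ∀ (U : C) (t : T.sec U), app φ t = app ψ t) : φ = ψ := by
  apply Hom.ext
  apply Sheaf.hom_ext
  ext U t
  exact h U.unop t

/-- A morphism of torsors from its action on sections. -/
def mkHom (a : ∀ {U : C}, T.sec U → T'.sec U)
    (hres : ∀ {U V : C} (g : V ⟶ U) (t : T.sec U), T'.res g (a t) = a (T.res g t))
    (hpr : ∀ {U : C} (t : T.sec U), T'.pr (a t) = T.pr t)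
    (hsmul : ∀ {U : C} (f : F.obj.obj (op U)) (t : T.sec U), a (f • t) = f • a t) : T ⟶ T' :=
  Hom.mk ⟨{ app := fun U => ↾(fun t => a (U := U.unop) t)
            naturality := fun U V g => by
              ext t
              exact (hres g.unop t).symm }⟩ hpr hsmul

@[simp] theorem app_mkHom (a : ∀ {U : C}, T.sec U → T'.sec U) (hres hpr hsmul) (t : T.sec U) :
    app (mkHom (T := T) (T' := T') a hres hpr hsmul) t = a t := rfl

theorem app_bijective (φ : T ⟶ T') (U : C) (t' : T'.sec U) : ∃! t : T.sec U, app φ t = t' := by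
  have inj : ∀ {V : C} (s t : T.sec V), app φ s = app φ t → s = t := by
    intro V s t h
    obtain ⟨f, rfl⟩ := T.exists_smul (t := s) (t' := t)
      (by rw [← pr_app φ s, h, pr_app])
    rw [app_smul] at h
    have h1 : (1 : F.obj.obj (op V)) = f := T'.smul_inj ((MulAction.one_smul _).trans h)
    rw [← h1, MulAction.one_smul]
  obtain ⟨R, hR, hx⟩ := T.local_sec (T'.pr t')
  obtain ⟨t, ht⟩ := T.glue hR
    (fun V g t => app φ t = T'.res g t')
    (fun V W g h t ht => by
      rw [← res_app, ht, res_res])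
    (fun V g t t' _ h h' => inj _ _ (h.trans h'.symm))
    (fun V g hg => by
      obtain ⟨t, ht⟩ := hx g hg
      obtain ⟨f, hf⟩ := T'.exists_smul (t := app φ t) (t' := T'.res g t') (by simp [ht])
      exact ⟨f • t, by rw [app_smul, hf]⟩)
  refine ⟨t, T'.sep hR fun V g hg => ?_, fun s hs => ?_⟩
  · rw [res_app]
    exact ht g hg
  · refine T.sep hR fun V g hg => inj _ _ ?_
    rw [← res_app, hs]
    exact (ht g hg).symm

/-- Every morphism of torsors is an isomorphism. -/
theorem isIso_hom (φ : T ⟶ T') : IsIso φ := by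
  choose b hb hb' using app_bijective φ
  have hbb : ∀ {U : C} (t : T.sec U), b U (app φ t) = t := fun t => (hb' _ _ t rfl).symm
  refine ⟨mkHom (fun {U} t => b U t) ?_ ?_ ?_, ?_, ?_⟩
  · intro U V g t
    apply hb'
    rw [← res_app]
    exact congrArg _ (hb U t)
  · intro U t
    rw [← pr_app φ]
    exact congrArg _ (hb U t)
  · intro U f t
    refine (hb' _ _ _ ?_).symm
    change app φ (f • b U t) = _
    rw [app_smul]
    exact congrArg _ (hb U t)
  · exact hom_ext fun U t => hbb t
  · exact hom_ext fun U t => hb U t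

end

end Torsor

section Coefficients

variable (F : Sheaf J CommGrpCat.{u + 1}) {U V W : C}

theorem coeff_map_id (f : F.obj.obj (op U)) : F.obj.map (𝟙 U).op f = f := by
  simp

theorem coeff_map_map (g : V ⟶ U) (h : W ⟶ V) (f : F.obj.obj (op U)) :
    F.obj.map h.op (F.obj.map g.op f) = F.obj.map (h ≫ g).op f := by
  simp

theorem coeff_sep {R : Sieve U} (hR : R ∈ J U) {x y : F.obj.obj (op U)}
    (h : ∀ ⦃V : C⦄ (g : V ⟶ U), R g → F.obj.map g.op x = F.obj.map g.op y) : x = y :=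
  sheaf_sep (underlying F).property hR h

theorem coeff_glue {R : Sieve U} (hR : R ∈ J U)
    (p : ∀ ⦃V : C⦄ (_ : V ⟶ U), F.obj.obj (op V) → Prop)
    (hres : ∀ ⦃V W : C⦄ (g : V ⟶ U) (h : W ⟶ V) (t : F.obj.obj (op V)),
      p g t → p (h ≫ g) (F.obj.map h.op t))
    (huniq : ∀ ⦃V : C⦄ (g : V ⟶ U) (t t' : F.obj.obj (op V)), R g → p g t → p g t' → t = t')
    (hex : ∀ ⦃V : C⦄ (g : V ⟶ U), R g → ∃ t, p g t) :
    ∃ t : F.obj.obj (op U), ∀ ⦃V : C⦄ (g : V ⟶ U), R g → p g (F.obj.map g.op t) :=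
  sheaf_glue (underlying F).property hR p hres huniq hex

end Coefficients

namespace Torsor

variable {F : Sheaf J CommGrpCat.{u + 1}} {X Y : C}

/-! ### The trivial torsor -/

section Trivial
variable [J.Subcanonical]

variable (F X) in
/-- The trivial torsor `F_X = F × X` over `X`. -/
def trivial : Torsor F X where
  sheaf :=
    { obj :=
        { obj := fun U => F.obj.obj U × (U.unop ⟶ X)
          map := fun g => ↾(fun p => (F.obj.map g p.1, g.unop ≫ p.2))
          map_id := fun U => by ext p <;> simp
          map_comp := fun g h => by ext p <;> simp }
      property := by
        refine isSheaf_of_sep_glue (fun U R hR x y h => ?_) (fun U R hR x hx => ?_)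
        · refine Prod.ext (coeff_sep F hR fun V g hg => congrArg Prod.fst (h g hg)) ?_
          exact sheaf_sep (isSheaf_yoneda X) hR fun V g hg => congrArg Prod.snd (h g hg)
        · obtain ⟨f, hf⟩ := sheaf_glue_family (underlying F).property hR
            (fun V g hg => (x g hg).1) (fun V W g h hg => congrArg Prod.fst (hx g h hg))
          obtain ⟨a, ha⟩ := sheaf_glue_family (isSheaf_yoneda X) hR
            (fun V g hg => (x g hg).2) (fun V W g h hg => congrArg Prod.snd (hx g h hg))
          exact ⟨(f, a), fun V g hg => Prod.ext (hf g hg) (ha g hg)⟩ }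
  proj p := p.2
  smul f p := (f * p.1, p.2)
  proj_map _ _ := rfl
  smul_map g f p := Prod.ext (map_mul (F.obj.map g.op).hom f p.1) rfl
  proj_smul _ _ := rfl
  one_smul p := Prod.ext (one_mul _) rfl
  mul_smul f f' p := Prod.ext (mul_assoc _ _ _) rfl
  simply_transitive {U} t t' h :=
    ⟨t'.1 * t.1⁻¹, Prod.ext (inv_mul_cancel_right _ _) h, fun f hf =>
      eq_mul_inv_of_mul_eq (congrArg Prod.fst hf)⟩
  locally_nonempty {U} x := ⟨⊤, J.top_mem U, fun V g _ => ⟨(1, g ≫ x), rfl⟩⟩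

/-- The section `(f, x)` of the trivial torsor. -/
def trivialSec {U : C} (f : F.obj.obj (op U)) (x : U ⟶ X) : (trivial F X).sec U := (f, x)

/-- The trivialisation `F_X ≅ P` of a torsor defined by a section `s : X ⟶ P`, given on
points. -/
def trivialise (P : Torsor F X) (s : ∀ {U : C}, (U ⟶ X) → P.sec U)
    (hpr : ∀ {U : C} (x : U ⟶ X), P.pr (s x) = x)
    (hres : ∀ {U V : C} (g : V ⟶ U) (x : U ⟶ X), P.res g (s x) = s (g ≫ x)) :
    trivial F X ≅ P :=
  haveI := isIso_hom (mkHom (T := trivial F X) (T' := P) (fun {U} p => (p.1 : F.obj.obj (op U)) • s p.2)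
    (fun g p => by rw [res_smul, hres]; rfl)
    (fun p => by rw [pr_smul, hpr]; rfl)
    (fun f p => SemigroupAction.mul_smul f p.1 (s p.2)))
  asIso (mkHom (T := trivial F X) (T' := P) (fun {U} p => (p.1 : F.obj.obj (op U)) • s p.2)
    (fun g p => by rw [res_smul, hres]; rfl)
    (fun p => by rw [pr_smul, hpr]; rfl)
    (fun f p => SemigroupAction.mul_smul f p.1 (s p.2)))

theorem app_trivialise (P : Torsor F X) (s : ∀ {U : C}, (U ⟶ X) → P.sec U) (hpr hres) {U : C}
    (f : F.obj.obj (op U)) (x : U ⟶ X) :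
    app (trivialise P s hpr hres).hom (trivialSec f x) = f • s x := rfl

end Trivial

/-! ### Pull-back -/

section Pullback
variable [J.Subcanonical]

/-- The presheaf `X ×_Y T`. -/
def pullbackPresheaf (f : X ⟶ Y) (T : Torsor F Y) : Cᵒᵖ ⥤ Type (u + 1) where
  obj U := { p : (U.unop ⟶ X) × T.sec U.unop // T.pr p.2 = p.1 ≫ f }
  map g := ↾(fun p => ⟨(g.unop ≫ p.1.1, T.res g.unop p.1.2), by
    rw [pr_res, Category.assoc, p.2]⟩)
  map_id U := by
    refine ConcreteCategory.hom_ext _ _ fun p => ?_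
    exact Subtype.ext (Prod.ext (Category.id_comp p.1.1) (T.res_id p.1.2))
  map_comp g h := by
    refine ConcreteCategory.hom_ext _ _ fun p => ?_
    exact Subtype.ext (Prod.ext (Category.assoc h.unop g.unop p.1.1)
      (T.res_res g.unop h.unop p.1.2).symm)

theorem pullbackPresheaf_isSheaf (f : X ⟶ Y) (T : Torsor F Y) :
    Presheaf.IsSheaf J (pullbackPresheaf f T) := by
  refine isSheaf_of_sep_glue (fun U R hR x y h => ?_) (fun U R hR x hx => ?_)
  · refine Subtype.ext (Prod.ext ?_ ?_)
    · exact sheaf_sep (isSheaf_yoneda X) hR fun V g hg => congrArg (fun p => p.1.1) (h g hg)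
    · exact T.sep hR fun V g hg => congrArg (fun p => p.1.2) (h g hg)
  · obtain ⟨t, ht⟩ := T.glue_family hR
      (fun V g hg => (x g hg).1.2) (fun V W g h hg => congrArg (fun p => p.1.2) (hx g h hg))
    obtain ⟨a, ha⟩ := sheaf_glue_family (isSheaf_yoneda X) hR
      (fun V g hg => (x g hg).1.1) (fun V W g h hg => congrArg (fun p => p.1.1) (hx g h hg))
    refine ⟨⟨(a, t), ?_⟩, fun V g hg => Subtype.ext (Prod.ext (ha g hg) (ht g hg))⟩
    refine sheaf_sep (isSheaf_yoneda Y) hR fun V g hg => ?_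
    change g ≫ T.pr t = g ≫ a ≫ f
    have h1 : g ≫ a = (x g hg).1.1 := ha g hg
    rw [← pr_res, ht g hg, ← Category.assoc]
    exact (x g hg).2.trans (congrArg (fun k => k ≫ f) h1.symm)

/-- The pull-back `f^* T = X ×_Y T` of a torsor over `Y` along `f : X ⟶ Y`. -/
def pullback (f : X ⟶ Y) (T : Torsor F Y) : Torsor F X where
  sheaf := ⟨pullbackPresheaf f T, pullbackPresheaf_isSheaf f T⟩
  proj p := p.1.1
  smul f p := ⟨(p.1.1, f • p.1.2), by rw [pr_smul, p.2]⟩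
  proj_map _ _ := rfl
  smul_map g f p := Subtype.ext (Prod.ext rfl (T.res_smul g f _))
  proj_smul _ _ := rfl
  one_smul p := Subtype.ext (Prod.ext rfl (MulAction.one_smul _))
  mul_smul f f' p := Subtype.ext (Prod.ext rfl (SemigroupAction.mul_smul _ _ _))
  simply_transitive {U} t t' h := by
    have h0 : t.1.1 = t'.1.1 := h
    obtain ⟨f, hf⟩ := T.exists_smul (t := t.1.2) (t' := t'.1.2) (by rw [t.2, t'.2, h0])
    exact ⟨f, Subtype.ext (Prod.ext h0 hf), fun f' hf' =>
      T.smul_inj (t := t.1.2) ((congrArg (fun p => p.1.2) hf').trans hf.symm)⟩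
  locally_nonempty {U} x := by
    obtain ⟨R, hR, h⟩ := T.local_sec (x ≫ f)
    refine ⟨R, hR, fun V g hg => ?_⟩
    obtain ⟨t, ht⟩ := h g hg
    exact ⟨⟨(g ≫ x, t), by rw [ht, Category.assoc]⟩, rfl⟩

/-- The section `(x, t)` of `X ×_Y T`. -/
def pullbackSec (f : X ⟶ Y) (T : Torsor F Y) {U : C} (x : U ⟶ X) (t : T.sec U)
    (h : T.pr t = x ≫ f) : (pullback f T).sec U := ⟨(x, t), h⟩

@[simp] theorem pr_pullbackSec (f : X ⟶ Y) (T : Torsor F Y) {U : C} (x : U ⟶ X) (t : T.sec U)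
    (h : T.pr t = x ≫ f) : (pullback f T).pr (pullbackSec f T x t h) = x := rfl

theorem res_pullbackSec (f : X ⟶ Y) (T : Torsor F Y) {U V : C} (g : V ⟶ U) (x : U ⟶ X)
    (t : T.sec U) (h : T.pr t = x ≫ f) : (pullback f T).res g (pullbackSec f T x t h) =
      pullbackSec f T (g ≫ x) (T.res g t) (by simp [h]) := rfl

theorem smul_pullbackSec (f : X ⟶ Y) (T : Torsor F Y) {U : C} (a : F.obj.obj (op U)) (x : U ⟶ X)
    (t : T.sec U) (h : T.pr t = x ≫ f) : a • pullbackSec f T x t h =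
      pullbackSec f T x (a • t) (by simp [h]) := rfl

/-- Pull-back of morphisms of torsors. -/
def pullbackMap (f : X ⟶ Y) {T T' : Torsor F Y} (φ : T ⟶ T') : pullback f T ⟶ pullback f T' :=
  mkHom (fun p => ⟨(p.1.1, app φ p.1.2), by rw [pr_app, p.2]⟩)
    (fun g p => Subtype.ext (Prod.ext rfl (res_app φ g _)))
    (fun p => rfl)
    (fun a p => Subtype.ext (Prod.ext rfl (app_smul φ a _)))

theorem app_pullbackMap (f : X ⟶ Y) {T T' : Torsor F Y} (φ : T ⟶ T') {U : C} (x : U ⟶ X)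
    (t : T.sec U) (h : T.pr t = x ≫ f) : app (pullbackMap f φ) (pullbackSec f T x t h) =
      pullbackSec f T' x (app φ t) (by simp [h]) := rfl

theorem pullbackMap_id (f : X ⟶ Y) (T : Torsor F Y) : pullbackMap f (𝟙 T) = 𝟙 _ := rfl

theorem pullbackMap_comp (f : X ⟶ Y) {T T' T'' : Torsor F Y} (φ : T ⟶ T') (ψ : T' ⟶ T'') :
    pullbackMap f (φ ≫ ψ) = pullbackMap f φ ≫ pullbackMap f ψ := rfl

end Pullback

/-! ### The dual torsor -/

/-- The dual torsor: the same sheaf over `X` with the inverse action of `F`. -/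
def dual (T : Torsor F X) : Torsor F X where
  sheaf := T.sheaf
  proj := T.proj
  smul f t := T.smul f⁻¹ t
  proj_map := T.proj_map
  smul_map g f t := by
    rw [T.smul_map]
    congr 1
    exact map_inv (F.obj.map g.op).hom f
  proj_smul f t := T.proj_smul _ t
  one_smul t := by rw [inv_one, T.one_smul]
  mul_smul f f' t := by rw [mul_inv, T.mul_smul]
  simply_transitive t t' h := by
    obtain ⟨f, hf, hu⟩ := T.simply_transitive t t' h
    refine ⟨f⁻¹, ?_, fun f' hf' => ?_⟩
    · change T.smul f⁻¹⁻¹ t = t'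
      rw [inv_inv, hf]
    · rw [← hu _ hf', inv_inv]
  locally_nonempty := T.locally_nonempty

/-- The section of the dual torsor given by a section of the torsor. -/
def dualSec (T : Torsor F X) {U : C} (t : T.sec U) : T.dual.sec U := t

@[simp] theorem pr_dualSec (T : Torsor F X) {U : C} (t : T.sec U) :
    T.dual.pr (T.dualSec t) = T.pr t := rfl

theorem res_dualSec (T : Torsor F X) {U V : C} (g : V ⟶ U) (t : T.sec U) :
    T.dual.res g (T.dualSec t) = T.dualSec (T.res g t) := rfl

theorem smul_dualSec (T : Torsor F X) {U : C} (f : F.obj.obj (op U)) (t : T.sec U) :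
    f • T.dualSec t = T.dualSec (f⁻¹ • t) := rfl

/-- The isomorphism of dual torsors induced by an isomorphism `T ⟶ T'`; it is the same morphism
of sheaves. -/
def dualMap {T T' : Torsor F X} (φ : T ⟶ T') : T.dual ⟶ T'.dual :=
  Hom.mk (T := T.dual) (T' := T'.dual) (Hom.hom (T := T) (T' := T') φ)
    (Hom.proj_hom (T := T) (T' := T') φ) (fun f t => Hom.smul_hom (T := T) (T' := T') φ f⁻¹ t)

theorem app_dualMap {T T' : Torsor F X} (φ : T ⟶ T') {U : C} (t : T.sec U) :
    app (dualMap φ) (T.dualSec t) = T'.dualSec (app φ t) := rfl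

theorem dualMap_id (T : Torsor F X) : dualMap (𝟙 T) = 𝟙 _ := rfl

theorem dualMap_comp {T T' T'' : Torsor F X} (φ : T ⟶ T') (ψ : T' ⟶ T'') :
    dualMap (φ ≫ ψ) = dualMap φ ≫ dualMap ψ := rfl

end Torsor

namespace Torsor

variable {F : Sheaf J CommGrpCat.{u + 1}} {X Y : C}

/-! ### The contracted product -/

section Tensor

variable (T T' : Torsor F X)

/-- Sections over `U` of the fibre product `T ×_X T'`. -/
abbrev Pair (U : C) : Type (u + 1) := { p : T.sec U × T'.sec U // T.pr p.1 = T'.pr p.2 }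

/-- The equivalence relation `(t, t') ∼ (f t, f⁻¹ t')` on `T ×_X T'`. -/
def pairSetoid (U : C) : Setoid (Pair T T' U) where
  r p q := ∃ f : F.obj.obj (op U), f • p.1.1 = q.1.1 ∧ f⁻¹ • p.1.2 = q.1.2
  iseqv :=
    { refl := fun p => ⟨1, MulAction.one_smul _, by rw [inv_one]; exact MulAction.one_smul _⟩
      symm := by
        rintro p q ⟨f, h1, h2⟩
        exact ⟨f⁻¹, by rw [← h1, inv_smul_smul], by rw [← h2, inv_inv, smul_inv_smul]⟩
      trans := by
        rintro p q r ⟨f, h1, h2⟩ ⟨g, h3, h4⟩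
        refine ⟨g * f, ?_, ?_⟩
        · rw [← h3, ← h1, SemigroupAction.mul_smul]
        · rw [← h4, ← h2, mul_inv, SemigroupAction.mul_smul] }

/-- Restriction of pairs. -/
def Pair.res {T T' : Torsor F X} {U V : C} (g : V ⟶ U) (p : Pair T T' U) : Pair T T' V :=
  ⟨(T.res g p.1.1, T'.res g p.1.2), by rw [pr_res, pr_res, p.2]⟩

theorem Pair.res_rel {T T' : Torsor F X} {U V : C} (g : V ⟶ U) {p q : Pair T T' U}
    (h : (pairSetoid T T' U).r p q) : (pairSetoid T T' V).r (p.res g) (q.res g) := by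
  obtain ⟨f, h1, h2⟩ := h
  refine ⟨F.obj.map g.op f, ?_, ?_⟩
  · exact (T.res_smul g f _).symm.trans (congrArg _ h1)
  · have h3 : (F.obj.map g.op f)⁻¹ = F.obj.map g.op f⁻¹ := (map_inv (F.obj.map g.op).hom f).symm
    rw [h3]
    exact (T'.res_smul g f⁻¹ _).symm.trans (congrArg _ h2)

/-- The presheaf quotient of `T ×_X T'` by the action `f (t, t') = (f t, f⁻¹ t')` of `F`. -/
def preTensor : Cᵒᵖ ⥤ Type (u + 1) where
  obj U := Quotient (pairSetoid T T' U.unop)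
  map {U V} g := ↾(Quotient.map' (s₁ := pairSetoid T T' U.unop) (s₂ := pairSetoid T T' V.unop)
    (Pair.res g.unop) (fun _ _ h => Pair.res_rel g.unop h))
  map_id U := by
    refine ConcreteCategory.hom_ext _ _ fun q => ?_
    induction q using Quotient.inductionOn with
    | _ p =>
      exact congrArg (Quotient.mk _) (Subtype.ext (Prod.ext (T.res_id p.1.1) (T'.res_id p.1.2)))
  map_comp g h := by
    refine ConcreteCategory.hom_ext _ _ fun q => ?_
    induction q using Quotient.inductionOn with
    | _ p =>
      exact congrArg (Quotient.mk _) (Subtype.ext (Prod.ext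
        (T.res_res g.unop h.unop p.1.1).symm (T'.res_res g.unop h.unop p.1.2).symm))

/-- The sheaf underlying the contracted product: the sheafification of the quotient. -/
def tensorSheaf : Sheaf J (Type (u + 1)) := (presheafToSheaf J (Type (u + 1))).obj (preTensor T T')

/-- Sections of the contracted product. -/
def tsec (U : C) : Type (u + 1) := (tensorSheaf T T').obj.obj (op U)

/-- Restriction of sections of the contracted product. -/
def tres {U V : C} (g : V ⟶ U) (x : tsec T T' U) : tsec T T' V := (tensorSheaf T T').obj.map g.op x

variable {T T'}

/-- The section `t ⊗ t'` of the contracted product, for `t`, `t'` over the same point of `X`. -/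
def tmk {U : C} (t : T.sec U) (t' : T'.sec U) (h : T.pr t = T'.pr t') : tsec T T' U :=
  (toSheafify J (preTensor T T')).app (op U) (Quotient.mk (pairSetoid T T' U) ⟨(t, t'), h⟩)

section Basic
variable {U V W : C}

theorem tres_id (x : tsec T T' U) : tres T T' (𝟙 U) x = x :=
  presheaf_map_id (tensorSheaf T T').obj x

theorem tres_tres (g : V ⟶ U) (h : W ⟶ V) (x : tsec T T' U) :
    tres T T' h (tres T T' g x) = tres T T' (h ≫ g) x :=
  presheaf_map_map (tensorSheaf T T').obj g h x

theorem tres_tmk (g : V ⟶ U) (t : T.sec U) (t' : T'.sec U) (h : T.pr t = T'.pr t') :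
    tres T T' g (tmk t t' h) = tmk (T.res g t) (T'.res g t') (by simp [h]) :=
  (NatTrans.naturality_apply (toSheafify J (preTensor T T')) g.op _).symm

theorem tmk_rel (f : F.obj.obj (op U)) (t : T.sec U) (t' : T'.sec U) (h : T.pr t = T'.pr t') :
    tmk (f • t) t' (by simp [h]) = tmk t (f • t') (by simp [h]) := by
  refine congrArg ((toSheafify J (preTensor T T')).app (op U)) (Quotient.sound ?_)
  exact ⟨f⁻¹, inv_smul_smul _ _, by rw [inv_inv]⟩

theorem tsep {R : Sieve U} (hR : R ∈ J U) {x y : tsec T T' U}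
    (h : ∀ ⦃V : C⦄ (g : V ⟶ U), R g → tres T T' g x = tres T T' g y) : x = y :=
  sheaf_sep (tensorSheaf T T').property hR h

theorem tglue {R : Sieve U} (hR : R ∈ J U) (p : ∀ ⦃V : C⦄ (_ : V ⟶ U), tsec T T' V → Prop)
    (hres : ∀ ⦃V W : C⦄ (g : V ⟶ U) (h : W ⟶ V) (t : tsec T T' V),
      p g t → p (h ≫ g) (tres T T' h t))
    (huniq : ∀ ⦃V : C⦄ (g : V ⟶ U) (t t' : tsec T T' V), R g → p g t → p g t' → t = t')
    (hex : ∀ ⦃V : C⦄ (g : V ⟶ U), R g → ∃ t, p g t) :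
    ∃ t : tsec T T' U, ∀ ⦃V : C⦄ (g : V ⟶ U), R g → p g (tres T T' g t) :=
  sheaf_glue (tensorSheaf T T').property hR p hres huniq hex

theorem tlocal (x : tsec T T' U) : ∃ R ∈ J U, ∀ ⦃V : C⦄ (g : V ⟶ U), R g →
    ∃ (t : T.sec V) (t' : T'.sec V) (h : T.pr t = T'.pr t'), tres T T' g x = tmk t t' h := by
  refine ⟨_, Presheaf.imageSieve_mem J (toSheafify J (preTensor T T')) (U := op U) x, ?_⟩
  rintro V g ⟨q, hq⟩
  induction q using Quotient.inductionOn with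
  | _ p => exact ⟨p.1.1, p.1.2, p.2, hq.symm⟩

theorem tmk_eq_local {t s : T.sec U} {t' s' : T'.sec U} {h : T.pr t = T'.pr t'}
    {k : T.pr s = T'.pr s'} (e : tmk t t' h = tmk s s' k) :
    ∃ R ∈ J U, ∀ ⦃V : C⦄ (g : V ⟶ U), R g → ∃ f : F.obj.obj (op V),
      f • T.res g t = T.res g s ∧ f⁻¹ • T'.res g t' = T'.res g s' := by
  refine ⟨_, Presheaf.equalizerSieve_mem J (toSheafify J (preTensor T T')) (X := op U) _ _ e, ?_⟩
  intro V g hg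
  exact Quotient.exact (s := pairSetoid T T' V) hg

theorem tmk_eq {t s : T.sec U} {t' s' : T'.sec U} {h : T.pr t = T'.pr t'}
    {k : T.pr s = T'.pr s'} (e : tmk t t' h = tmk s s' k) :
    ∃ f : F.obj.obj (op U), f • t = s ∧ f⁻¹ • t' = s' := by
  obtain ⟨R, hR, H⟩ := tmk_eq_local e
  obtain ⟨f, hf⟩ := coeff_glue F hR
    (fun V g f => f • T.res g t = T.res g s ∧ f⁻¹ • T'.res g t' = T'.res g s')
    (fun V W g h f hf => by
      have h3 : (F.obj.map h.op f)⁻¹ = F.obj.map h.op f⁻¹ := (map_inv (F.obj.map h.op).hom f).symm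
      rw [h3]
      constructor
      · rw [← res_res, ← res_smul, hf.1, res_res]
      · rw [← res_res, ← res_smul, hf.2, res_res])
    (fun V g f f' _ hf hf' => T.smul_inj (hf.1.trans hf'.1.symm)) H
  refine ⟨f, T.sep hR fun V g hg => ?_, T'.sep hR fun V g hg => ?_⟩
  · rw [res_smul, (hf g hg).1]
  · have h3 : F.obj.map g.op f⁻¹ = (F.obj.map g.op f)⁻¹ := map_inv (F.obj.map g.op).hom f
    rw [res_smul, h3, (hf g hg).2]

/-- The element `y` is `f x`, if this holds for all local representatives `t ⊗ t'` of `x`. -/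
def IsSmul (f : F.obj.obj (op U)) (x y : tsec T T' U) : Prop :=
  ∀ ⦃V : C⦄ (g : V ⟶ U) (t : T.sec V) (t' : T'.sec V) (h : T.pr t = T'.pr t'),
    tres T T' g x = tmk t t' h →
      tres T T' g y = tmk ((F.obj.map g.op f : F.obj.obj (op V)) • t) t' (by simp [h])

theorem isSmul_tmk (f : F.obj.obj (op U)) (t : T.sec U) (t' : T'.sec U) (h : T.pr t = T'.pr t') :
    IsSmul f (tmk t t' h) (tmk (f • t) t' (by simp [h])) := by
  intro V g s s' k e
  rw [tres_tmk] at e ⊢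
  obtain ⟨a, rfl, ha⟩ := tmk_eq e
  have ha' : T'.res g t' = a • s' := by rw [← ha, smul_inv_smul]
  simp only [ha', res_smul, smul_smul, mul_comm _ a]
  rw [← tmk_rel]
  · simp only [smul_smul]
  · rw [pr_smul, ← k, pr_smul]

theorem existsUnique_isSmul (f : F.obj.obj (op U)) (x : tsec T T' U) : ∃! y, IsSmul f x y := by
  obtain ⟨R, hR, H⟩ := tlocal x
  obtain ⟨y, hy⟩ := tglue hR
    (fun V g y => IsSmul (F.obj.map g.op f : F.obj.obj (op V)) (tres T T' g x) y)
    (fun V W g h y hy V' g' t t' k e => by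
      rw [tres_tres] at e ⊢
      rw [← tres_tres, tres_tres] at e
      rw [hy (g' ≫ h) t t' k (by rw [← e, tres_tres, Category.assoc])]
      simp only [coeff_map_map, Category.assoc])
    (fun V g y y' hg hy hy' => by
      obtain ⟨t, t', h, e⟩ := H g hg
      rw [← tres_id y, ← tres_id y', hy (𝟙 V) t t' h (by rw [tres_id, e]),
        hy' (𝟙 V) t t' h (by rw [tres_id, e])])
    (fun V g hg => by
      obtain ⟨t, t', h, e⟩ := H g hg
      exact ⟨_, e ▸ isSmul_tmk _ t t' h⟩)
  refine ⟨y, fun V g t t' h e => ?_, fun y' hy' => tsep hR fun V g hg => ?_⟩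
  · refine tsep (J.pullback_stable g hR) fun W k hk => ?_
    have := hy (k ≫ g) hk (𝟙 W) (T.res k t) (T'.res k t') (by simp [h])
      (by rw [tres_id, ← tres_tres, e, tres_tmk])
    rw [tres_id] at this
    rw [tres_tres, this, tres_tmk]
    simp only [res_smul, coeff_map_map, Category.id_comp]
  · obtain ⟨t, t', h, e⟩ := H g hg
    have := hy g hg (𝟙 V) t t' h (by rw [tres_id, e])
    rw [tres_id] at this
    rw [hy' g t t' h e, this]
    simp only [coeff_map_id]

/-- The action of `F` on the contracted product; on pure tensors, `f (t ⊗ t') = f t ⊗ t'`. -/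
def tsmul (f : F.obj.obj (op U)) (x : tsec T T' U) : tsec T T' U :=
  (existsUnique_isSmul f x).choose

theorem tsmul_spec (f : F.obj.obj (op U)) (x : tsec T T' U) : IsSmul f x (tsmul f x) :=
  (existsUnique_isSmul f x).choose_spec.1

theorem tsmul_unique {f : F.obj.obj (op U)} {x y : tsec T T' U} (h : IsSmul f x y) :
    tsmul f x = y := (existsUnique_isSmul f x).unique (tsmul_spec f x) h

theorem tsmul_tmk (f : F.obj.obj (op U)) (t : T.sec U) (t' : T'.sec U) (h : T.pr t = T'.pr t') :
    tsmul f (tmk t t' h) = tmk (f • t) t' (by simp [h]) := tsmul_unique (isSmul_tmk f t t' h)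

theorem tres_tsmul (g : V ⟶ U) (f : F.obj.obj (op U)) (x : tsec T T' U) :
    tres T T' g (tsmul f x) = tsmul (F.obj.map g.op f) (tres T T' g x) := by
  refine (tsmul_unique fun W k t t' h e => ?_).symm
  rw [tres_tres] at e ⊢
  rw [tsmul_spec f x (k ≫ g) t t' h e]
  simp only [coeff_map_map]

/-- The point of `X` under a section of the contracted product, if `t ⊗ t'` lies over the same
point as `t` and `t'`. -/
def IsProj (x : tsec T T' U) (a : U ⟶ X) : Prop :=
  ∀ ⦃V : C⦄ (g : V ⟶ U) (t : T.sec V) (t' : T'.sec V) (h : T.pr t = T'.pr t'),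
    tres T T' g x = tmk t t' h → g ≫ a = T.pr t

theorem isProj_tmk (t : T.sec U) (t' : T'.sec U) (h : T.pr t = T'.pr t') :
    IsProj (tmk t t' h) (T.pr t) := by
  intro V g s s' k e
  rw [tres_tmk] at e
  obtain ⟨a, rfl, -⟩ := tmk_eq e
  simp

variable [J.Subcanonical]

theorem existsUnique_isProj (x : tsec T T' U) : ∃! a, IsProj x a := by
  obtain ⟨R, hR, H⟩ := tlocal x
  obtain ⟨a, ha⟩ := sheaf_glue (isSheaf_yoneda X) hR
    (fun V g a => IsProj (tres T T' g x) a)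
    (fun V W g h a ha V' g' t t' k e => by
      refine Eq.trans ?_ (ha (g' ≫ h) t t' k (by rw [← e, tres_tres, tres_tres, Category.assoc]))
      exact (Category.assoc _ _ _).symm)
    (fun V g a a' hg ha ha' => by
      obtain ⟨t, t', h, e⟩ := H g hg
      have h1 := ha (𝟙 V) t t' h (by rw [tres_id, e])
      have h2 := ha' (𝟙 V) t t' h (by rw [tres_id, e])
      exact (Category.id_comp _).symm.trans (h1.trans (h2.symm.trans (Category.id_comp _))))
    (fun V g hg => by
      obtain ⟨t, t', h, e⟩ := H g hg
      exact ⟨T.pr t, e ▸ isProj_tmk t t' h⟩)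
  refine ⟨a, fun V g t t' h e => ?_, fun a' ha' => ?_⟩
  · refine sheaf_sep (isSheaf_yoneda X) (J.pullback_stable g hR) fun W k hk => ?_
    have := ha (k ≫ g) hk (𝟙 W) (T.res k t) (T'.res k t') (by simp [h])
      (by rw [tres_id, ← tres_tres, e, tres_tmk])
    change k ≫ g ≫ a = k ≫ T.pr t
    rw [← pr_res, ← this]
    exact (Category.assoc _ _ _).symm.trans (Category.id_comp _).symm
  · refine sheaf_sep (isSheaf_yoneda X) hR fun V g hg => ?_
    obtain ⟨t, t', h, e⟩ := H g hg
    have := ha g hg (𝟙 V) t t' h (by rw [tres_id, e])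
    exact (ha' g t t' h e).trans (this.symm.trans (Category.id_comp _))

/-- The structure morphism to `X` of the contracted product. -/
def tpr (x : tsec T T' U) : U ⟶ X := (existsUnique_isProj x).choose

theorem tpr_spec (x : tsec T T' U) : IsProj x (tpr x) := (existsUnique_isProj x).choose_spec.1

theorem tpr_unique {x : tsec T T' U} {a : U ⟶ X} (h : IsProj x a) : tpr x = a :=
  (existsUnique_isProj x).unique (tpr_spec x) h

theorem tpr_tmk (t : T.sec U) (t' : T'.sec U) (h : T.pr t = T'.pr t') :
    tpr (tmk t t' h) = T.pr t := tpr_unique (isProj_tmk t t' h)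

theorem tpr_tres (g : V ⟶ U) (x : tsec T T' U) : tpr (tres T T' g x) = g ≫ tpr x := by
  refine tpr_unique fun W k t t' h e => ?_
  rw [tres_tres] at e
  rw [← tpr_spec x (k ≫ g) t t' h e, Category.assoc]

theorem hom_sep {R : Sieve U} (hR : R ∈ J U) {x y : U ⟶ X}
    (h : ∀ ⦃V : C⦄ (g : V ⟶ U), R g → g ≫ x = g ≫ y) : x = y :=
  sheaf_sep (isSheaf_yoneda X) hR h

end Basic

variable [J.Subcanonical]

theorem tpr_tsmul {U : C} (f : F.obj.obj (op U)) (x : tsec T T' U) : tpr (tsmul f x) = tpr x := by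
  obtain ⟨R, hR, H⟩ := tlocal x
  refine hom_sep hR fun V g hg => ?_
  obtain ⟨t, t', h, e⟩ := H g hg
  rw [← tpr_tres, ← tpr_tres, tres_tsmul, e, tsmul_tmk, tpr_tmk, tpr_tmk, pr_smul]

variable (T T')

/-- The contracted product `T ⊗ T'` of two `F`-torsors over `X`: the quotient sheaf of `T ×_X T'`
by the action `f (t, t') = (f t, f⁻¹ t')` of `F`, with `F` acting on either factor. -/
def tensor : Torsor F X where
  sheaf := tensorSheaf T T'
  proj x := tpr (T := T) (T' := T') x
  smul f x := tsmul (T := T) (T' := T') f x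
  proj_map g x := tpr_tres g x
  smul_map g f x := tres_tsmul g f x
  proj_smul f x := tpr_tsmul f x
  one_smul {U} x := by
    change tsec T T' U at x
    obtain ⟨R, hR, H⟩ := tlocal x
    refine tsep (T := T) (T' := T') hR fun V g hg => ?_
    obtain ⟨t, t', h, e⟩ := H g hg
    rw [tres_tsmul, e, tsmul_tmk]
    simp only [map_one, MulAction.one_smul]
  mul_smul {U} f f' x := by
    change tsec T T' U at x
    obtain ⟨R, hR, H⟩ := tlocal x
    refine tsep (T := T) (T' := T') hR fun V g hg => ?_
    obtain ⟨t, t', h, e⟩ := H g hg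
    rw [tres_tsmul, tres_tsmul, tres_tsmul, e, tsmul_tmk, tsmul_tmk, tsmul_tmk]
    simp only [map_mul, SemigroupAction.mul_smul]
  simply_transitive {U} x y hxy := by
    change tsec T T' U at x
    change tsec T T' U at y
    change tpr x = tpr y at hxy
    obtain ⟨R, hR, H⟩ := tlocal x
    obtain ⟨R', hR', H'⟩ := tlocal y
    have inj : ∀ {V : C} (g : V ⟶ U) (f f' : F.obj.obj (op V)), R g →
        tsmul f (tres T T' g x) = tsmul f' (tres T T' g x) → f = f' := by
      intro V g f f' hg e
      obtain ⟨t, t', h, e'⟩ := H g hg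
      rw [e', tsmul_tmk, tsmul_tmk] at e
      obtain ⟨a, h1, h2⟩ := tmk_eq e
      have h3 : a⁻¹ = 1 := T'.smul_inj (h2.trans (MulAction.one_smul _).symm)
      rw [inv_eq_one] at h3
      rw [h3, MulAction.one_smul] at h1
      exact T.smul_inj h1
    have hRR := J.intersection_covering hR hR'
    obtain ⟨f, hf⟩ := coeff_glue F hRR
      (fun V g f => tsmul f (tres T T' g x) = tres T T' g y)
      (fun V W g h f hf => by rw [← tres_tres, ← tres_tsmul, hf, tres_tres])
      (fun V g f f' hg hf hf' => inj g f f' hg.1 (hf.trans hf'.symm))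
      (fun V g hg => by
        obtain ⟨t, t', h, e⟩ := H g hg.1
        obtain ⟨s, s', k, e'⟩ := H' g hg.2
        have hts : T.pr t = T.pr s := by
          rw [← tpr_tmk t t' h, ← tpr_tmk s s' k, ← e, ← e', tpr_tres, tpr_tres, hxy]
        obtain ⟨a, ha⟩ := T.exists_smul hts
        obtain ⟨b, hb⟩ := T'.exists_smul (t := t') (t' := s') (by rw [← h, ← k, hts])
        refine ⟨b * a, ?_⟩
        rw [e, e', tsmul_tmk]
        simp only [SemigroupAction.mul_smul, ha]
        rw [tmk_rel _ _ _ (by rw [← hts, h])]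
        simp only [hb])
    refine ⟨f, tsep (T := T) (T' := T') hRR fun V g hg => ?_, fun f' hf' => ?_⟩
    · rw [tres_tsmul, hf g hg]
    · refine coeff_sep F hRR fun V g hg => inj g _ _ hg.1 ?_
      rw [← tres_tsmul, ← tres_tsmul]
      refine (congrArg (tres T T' g) hf').trans ?_
      rw [tres_tsmul, hf g hg]
  locally_nonempty {U} x := by
    obtain ⟨R, hR, H⟩ := T.local_sec x
    obtain ⟨R', hR', H'⟩ := T'.local_sec x
    refine ⟨_, J.intersection_covering hR hR', fun V g hg => ?_⟩
    obtain ⟨t, ht⟩ := H g hg.1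
    obtain ⟨t', ht'⟩ := H' g hg.2
    exact ⟨tmk t t' (ht.trans ht'.symm), (tpr_tmk _ _ _).trans ht⟩

variable {T T'}

/-- The section `t ⊗ t'` of the contracted product, for `t`, `t'` over the same point of `X`. -/
def tmul {U : C} (t : T.sec U) (t' : T'.sec U) (h : T.pr t = T'.pr t') : (tensor T T').sec U :=
  tmk t t' h

section
variable {U V : C}

@[simp] theorem pr_tmul (t : T.sec U) (t' : T'.sec U) (h : T.pr t = T'.pr t') :
    (tensor T T').pr (tmul t t' h) = T.pr t := tpr_tmk t t' h

theorem tmul_congr {t s : T.sec U} {t' s' : T'.sec U} (h : T.pr t = T'.pr t') (e : t = s)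
    (e' : t' = s') : tmul t t' h = tmul s s' (by rw [← e, ← e', h]) := by
  subst e e'
  rfl

theorem res_tmul (g : V ⟶ U) (t : T.sec U) (t' : T'.sec U) (h : T.pr t = T'.pr t') :
    (tensor T T').res g (tmul t t' h) = tmul (T.res g t) (T'.res g t') (by simp [h]) :=
  tres_tmk g t t' h

theorem smul_tmul_left (f : F.obj.obj (op U)) (t : T.sec U) (t' : T'.sec U)
    (h : T.pr t = T'.pr t') : tmul (f • t) t' (by simp [h]) = f • tmul t t' h :=
  (tsmul_tmk f t t' h).symm

theorem smul_tmul_right (f : F.obj.obj (op U)) (t : T.sec U) (t' : T'.sec U)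
    (h : T.pr t = T'.pr t') : tmul t (f • t') (by simp [h]) = f • tmul t t' h :=
  (tmk_rel f t t' h).symm.trans (smul_tmul_left f t t' h)

theorem smul_tmul_smul (f f' : F.obj.obj (op U)) (t : T.sec U) (t' : T'.sec U)
    (h : T.pr t = T'.pr t') : tmul (f • t) (f' • t') (by simp [h]) = (f * f') • tmul t t' h := by
  rw [smul_tmul_left f t (f' • t') (by simp [h]), smul_tmul_right f' t t' h,
    SemigroupAction.mul_smul]

theorem tmul_local (x : (tensor T T').sec U) : ∃ R ∈ J U, ∀ ⦃V : C⦄ (g : V ⟶ U), R g →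
    ∃ (t : T.sec V) (t' : T'.sec V) (h : T.pr t = T'.pr t'),
      (tensor T T').res g x = tmul t t' h := tlocal x

end

variable {S S' : Torsor F X}

/-- The map of presheaf quotients induced by morphisms of torsors. -/
def preTensorMap (φ : T ⟶ S) (ψ : T' ⟶ S') : preTensor T T' ⟶ preTensor S S' where
  app U := ↾(Quotient.map' (s₁ := pairSetoid T T' U.unop) (s₂ := pairSetoid S S' U.unop)
    (fun p => ⟨(app φ p.1.1, app ψ p.1.2), by rw [pr_app, pr_app, p.2]⟩)
    (fun p q ⟨f, h1, h2⟩ => ⟨f, (app_smul φ f _).symm.trans (congrArg _ h1),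
      (app_smul ψ f⁻¹ _).symm.trans (congrArg _ h2)⟩))
  naturality U V g := by
    refine ConcreteCategory.hom_ext _ _ fun q => ?_
    induction q using Quotient.inductionOn with
    | _ p =>
      exact congrArg (Quotient.mk _) (Subtype.ext (Prod.ext
        (res_app φ g.unop p.1.1).symm (res_app ψ g.unop p.1.2).symm))

/-- The induced morphism of sheaves on sections. -/
def tmap (φ : T ⟶ S) (ψ : T' ⟶ S') {U : C} (x : (tensor T T').sec U) : (tensor S S').sec U :=
  ((presheafToSheaf J (Type (u + 1))).map (preTensorMap φ ψ)).hom.app (op U) x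

theorem tmap_tmul (φ : T ⟶ S) (ψ : T' ⟶ S') {U : C} (t : T.sec U) (t' : T'.sec U)
    (h : T.pr t = T'.pr t') :
    tmap φ ψ (tmul t t' h) = tmul (app φ t) (app ψ t') (by simp [h]) := by
  have := congrArg (fun k => k.app (op U)) (toSheafify_naturality J (preTensorMap φ ψ))
  exact (ConcreteCategory.congr_hom this (Quotient.mk (pairSetoid T T' U) ⟨(t, t'), h⟩)).symm

theorem res_tmap (φ : T ⟶ S) (ψ : T' ⟶ S') {U V : C} (g : V ⟶ U) (x : (tensor T T').sec U) :
    (tensor S S').res g (tmap φ ψ x) = tmap φ ψ ((tensor T T').res g x) :=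
  (NatTrans.naturality_apply ((presheafToSheaf J (Type (u + 1))).map (preTensorMap φ ψ)).hom
    g.op x).symm

/-- Functoriality of the contracted product. -/
def tensorMap (φ : T ⟶ S) (ψ : T' ⟶ S') : tensor T T' ⟶ tensor S S' :=
  mkHom (fun x => tmap φ ψ x) (fun g x => res_tmap φ ψ g x)
    (fun {U} x => by
      obtain ⟨R, hR, H⟩ := tmul_local x
      refine hom_sep hR fun V g hg => ?_
      obtain ⟨t, t', h, e⟩ := H g hg
      rw [← pr_res, ← pr_res, res_tmap, e, tmap_tmul, pr_tmul, pr_tmul, pr_app])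
    (fun {U} f x => by
      obtain ⟨R, hR, H⟩ := tmul_local x
      refine sep _ hR fun V g hg => ?_
      obtain ⟨t, t', h, e⟩ := H g hg
      rw [res_tmap, res_smul, res_smul, res_tmap, e, tmap_tmul, ← smul_tmul_left, tmap_tmul,
        ← smul_tmul_left]
      simp only [app_smul])

theorem app_tensorMap (φ : T ⟶ S) (ψ : T' ⟶ S') {U : C} (t : T.sec U) (t' : T'.sec U)
    (h : T.pr t = T'.pr t') :
    app (tensorMap φ ψ) (tmul t t' h) = tmul (app φ t) (app ψ t') (by simp [h]) :=
  tmap_tmul φ ψ t t' h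

/-- Morphisms out of a contracted product are determined by pure tensors. -/
theorem tensor_hom_ext {P : Torsor F X} {φ ψ : tensor T T' ⟶ P}
    (H : ∀ (U : C) (t : T.sec U) (t' : T'.sec U) (h : T.pr t = T'.pr t'),
      app φ (tmul t t' h) = app ψ (tmul t t' h)) : φ = ψ := by
  refine hom_ext fun U x => ?_
  obtain ⟨R, hR, K⟩ := tmul_local x
  refine sep _ hR fun V g hg => ?_
  obtain ⟨t, t', h, e⟩ := K g hg
  rw [res_app, res_app, e, H]

theorem tensorMap_id (T T' : Torsor F X) : tensorMap (𝟙 T) (𝟙 T') = 𝟙 (tensor T T') :=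
  tensor_hom_ext fun _ t t' h => app_tensorMap _ _ t t' h

theorem tensorMap_comp {P P' : Torsor F X} (φ : T ⟶ S) (ψ : T' ⟶ S') (φ' : S ⟶ P) (ψ' : S' ⟶ P') :
    tensorMap (φ ≫ φ') (ψ ≫ ψ') = tensorMap φ ψ ≫ tensorMap φ' ψ' :=
  tensor_hom_ext fun _ t t' h => by
    rw [app_comp, app_tensorMap, app_tensorMap, app_tensorMap]
    rfl

end Tensor

end Torsor

/-! ### Extension data -/

section Simplicial

variable [CartesianMonoidalCategory C] (G : C)

/-- The morphism `p_{0,1} = id × p₀ : G³ ⟶ G²`. -/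
def p01 : G ⊗ G ⊗ G ⟶ G ⊗ G := G ◁ fst G G

/-- The morphism `p_{1,2} = p₁ × id : G³ ⟶ G²`. -/
def p12 : G ⊗ G ⊗ G ⟶ G ⊗ G := (α_ G G G).inv ≫ snd G G ▷ G

theorem p12_fst : p12 G ≫ fst G G = p01 G ≫ snd G G := by simp [p12, p01]

variable [GrpObj G]

/-- The morphism `m_{0,1} = m × id : G³ ⟶ G²`. -/
def m01 : G ⊗ G ⊗ G ⟶ G ⊗ G := (α_ G G G).inv ≫ μ[G] ▷ G

/-- The morphism `m_{1,2} = id × m : G³ ⟶ G²`. -/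
def m12 : G ⊗ G ⊗ G ⟶ G ⊗ G := G ◁ μ[G]

theorem m01_fst : m01 G ≫ fst G G = p01 G ≫ μ[G] := by
  simp only [m01, p01, Category.assoc, whiskerRight_fst]
  rw [← Category.assoc]
  congr 1
  ext <;> simp

theorem m01_snd : m01 G ≫ snd G G = p12 G ≫ snd G G := by simp [m01, p12]

theorem m12_fst : m12 G ≫ fst G G = p01 G ≫ fst G G := by simp [m12, p01]

theorem m12_snd : m12 G ≫ snd G G = p12 G ≫ μ[G] := by
  simp only [m12, p12, whiskerLeft_snd]
  congr 1
  ext <;> simp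

theorem m12_mul : m12 G ≫ μ[G] = m01 G ≫ μ[G] := by
  simp [m12, m01]

end Simplicial

open ExtData.Torsor

section Delta

variable [CartesianMonoidalCategory C] [J.Subcanonical]
variable (F : Sheaf J CommGrpCat.{u + 1}) (G : C) [GrpObj G]

/-- The functor `δ¹ T = p₁^* T ⊗ (m^* T)^∨ ⊗ p₀^* T` from `F`-torsors over `G` to `F`-torsors
over `G²`. -/
def delta1 : Torsor F G ⥤ Torsor F (G ⊗ G) where
  obj T := tensor (tensor (pullback (snd G G) T) (dual (pullback μ[G] T))) (pullback (fst G G) T)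
  map φ := tensorMap (tensorMap (pullbackMap (snd G G) φ) (dualMap (pullbackMap μ[G] φ)))
    (pullbackMap (fst G G) φ)
  map_id T := by
    simp only [pullbackMap_id, dualMap_id, tensorMap_id]
  map_comp φ ψ := by
    simp only [pullbackMap_comp, dualMap_comp, tensorMap_comp]

/-- The functor `δ² P = p_{1,2}^* P ⊗ (m_{0,1}^* P)^∨ ⊗ m_{1,2}^* P ⊗ (p_{0,1}^* P)^∨` from
`F`-torsors over `G²` to `F`-torsors over `G³`. -/
def delta2 : Torsor F (G ⊗ G) ⥤ Torsor F (G ⊗ G ⊗ G) where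
  obj P := tensor (tensor (tensor (pullback (p12 G) P) (dual (pullback (m01 G) P)))
    (pullback (m12 G) P)) (dual (pullback (p01 G) P))
  map φ := tensorMap (tensorMap (tensorMap (pullbackMap (p12 G) φ)
    (dualMap (pullbackMap (m01 G) φ))) (pullbackMap (m12 G) φ)) (dualMap (pullbackMap (p01 G) φ))
  map_id P := by
    simp only [pullbackMap_id, dualMap_id, tensorMap_id]
  map_comp φ ψ := by
    simp only [pullbackMap_comp, dualMap_comp, tensorMap_comp]

variable {F G} {U V : C}

/-- The section `b ⊗ c^∨ ⊗ a` of `δ¹ T` over a point `x` of `G²`, where `a`, `b`, `c` are sections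
of `T` over `p₀ x`, `p₁ x` and `m x`. -/
def delta1Sec (T : Torsor F G) (x : U ⟶ G ⊗ G) (b c a : T.sec U) (hb : T.pr b = x ≫ snd G G)
    (hc : T.pr c = x ≫ μ[G]) (ha : T.pr a = x ≫ fst G G) : ((delta1 F G).obj T).sec U :=
  tmul (tmul (pullbackSec (snd G G) T x b hb) (dualSec _ (pullbackSec μ[G] T x c hc))
    (by rw [pr_dualSec, pr_pullbackSec, pr_pullbackSec]))
    (pullbackSec (fst G G) T x a ha) (by rw [pr_tmul, pr_pullbackSec, pr_pullbackSec])

/-- The section `s₁ ⊗ s₂^∨ ⊗ s₃ ⊗ s₄^∨` of `δ² P` over a point `x` of `G³`, where `s₁`, `s₂`,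
`s₃`, `s₄` are sections of `P` over the points `p_{1,2} x`, `m_{0,1} x`, `m_{1,2} x`,
`p_{0,1} x`. -/
def delta2Sec (P : Torsor F (G ⊗ G)) (x : U ⟶ G ⊗ G ⊗ G) (s₁ s₂ s₃ s₄ : P.sec U)
    (h₁ : P.pr s₁ = x ≫ p12 G) (h₂ : P.pr s₂ = x ≫ m01 G) (h₃ : P.pr s₃ = x ≫ m12 G)
    (h₄ : P.pr s₄ = x ≫ p01 G) : ((delta2 F G).obj P).sec U :=
  tmul (tmul (tmul (pullbackSec (p12 G) P x s₁ h₁) (dualSec _ (pullbackSec (m01 G) P x s₂ h₂))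
        (by rw [pr_dualSec, pr_pullbackSec, pr_pullbackSec]))
      (pullbackSec (m12 G) P x s₃ h₃) (by rw [pr_tmul, pr_pullbackSec, pr_pullbackSec]))
    (dualSec _ (pullbackSec (p01 G) P x s₄ h₄))
    (by rw [pr_tmul, pr_tmul, pr_dualSec, pr_pullbackSec, pr_pullbackSec])

section
variable (T : Torsor F G) (x : U ⟶ G ⊗ G) (b c a : T.sec U) (hb : T.pr b = x ≫ snd G G)
    (hc : T.pr c = x ≫ μ[G]) (ha : T.pr a = x ≫ fst G G)

theorem delta1Sec_congr {T : Torsor F G} {x x' : U ⟶ G ⊗ G} {b c a b' c' a' : T.sec U}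
    (hb : T.pr b = x ≫ snd G G) (hc : T.pr c = x ≫ μ[G]) (ha : T.pr a = x ≫ fst G G)
    (ex : x = x') (eb : b = b') (ec : c = c') (ea : a = a') :
    delta1Sec T x b c a hb hc ha = delta1Sec T x' b' c' a' (by rw [← eb, ← ex, hb])
      (by rw [← ec, ← ex, hc]) (by rw [← ea, ← ex, ha]) := by
  subst ex eb ec ea
  rfl

theorem pr_delta1Sec : ((delta1 F G).obj T).pr (delta1Sec T x b c a hb hc ha) = x :=
  (pr_tmul _ _ _).trans (pr_tmul _ _ _)

theorem res_delta1Sec (g : V ⟶ U) :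
    ((delta1 F G).obj T).res g (delta1Sec T x b c a hb hc ha) =
      delta1Sec T (g ≫ x) (T.res g b) (T.res g c) (T.res g a)
        (by simp [hb]) (by simp [hc]) (by simp [ha]) := by
  exact (res_tmul _ _ _ _).trans (tmul_congr _ (res_tmul _ _ _ _) rfl)

theorem delta1Sec_smul (fb fc fa : F.obj.obj (op U)) :
    delta1Sec T x (fb • b) (fc • c) (fa • a) (by simp [hb]) (by simp [hc]) (by simp [ha]) =
      (fb * fc⁻¹ * fa) • delta1Sec T x b c a hb hc ha := by
  have e : dualSec _ (pullbackSec μ[G] T x (fc • c) (by simp [hc])) =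
      fc⁻¹ • dualSec _ (pullbackSec μ[G] T x c hc) := by
    rw [smul_dualSec, inv_inv, smul_pullbackSec]
  have h0 : (pullback (snd G G) T).pr (pullbackSec (snd G G) T x b hb) =
      (dual (pullback μ[G] T)).pr (dualSec _ (pullbackSec μ[G] T x c hc)) := by
    rw [pr_dualSec, pr_pullbackSec, pr_pullbackSec]
  have h1 := smul_tmul_smul fb fc⁻¹ _ _ h0
  exact (tmul_congr _ ((tmul_congr _ rfl e).trans h1) rfl).trans
    (smul_tmul_smul (fb * fc⁻¹) fa (tmul _ _ h0) (pullbackSec (fst G G) T x a ha)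
      (by rw [pr_tmul, pr_pullbackSec, pr_pullbackSec]))

theorem app_delta1_map {T' : Torsor F G} (φ : T ⟶ T') :
    app ((delta1 F G).map φ) (delta1Sec T x b c a hb hc ha) =
      delta1Sec T' x (app φ b) (app φ c) (app φ a) (by simp [hb]) (by simp [hc])
        (by simp [ha]) := by
  exact (app_tensorMap _ _ _ _ _).trans (tmul_congr _ (app_tensorMap _ _ _ _ _) rfl)

end

section
variable (P : Torsor F (G ⊗ G)) (x : U ⟶ G ⊗ G ⊗ G) (s₁ s₂ s₃ s₄ : P.sec U)
    (h₁ : P.pr s₁ = x ≫ p12 G) (h₂ : P.pr s₂ = x ≫ m01 G) (h₃ : P.pr s₃ = x ≫ m12 G)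
    (h₄ : P.pr s₄ = x ≫ p01 G)

theorem delta2Sec_congr {P : Torsor F (G ⊗ G)} {x : U ⟶ G ⊗ G ⊗ G}
    {s₁ s₂ s₃ s₄ s₁' s₂' s₃' s₄' : P.sec U}
    (h₁ : P.pr s₁ = x ≫ p12 G) (h₂ : P.pr s₂ = x ≫ m01 G) (h₃ : P.pr s₃ = x ≫ m12 G)
    (h₄ : P.pr s₄ = x ≫ p01 G) (e₁ : s₁ = s₁') (e₂ : s₂ = s₂') (e₃ : s₃ = s₃') (e₄ : s₄ = s₄') :
    delta2Sec P x s₁ s₂ s₃ s₄ h₁ h₂ h₃ h₄ = delta2Sec P x s₁' s₂' s₃' s₄' (by rw [← e₁, h₁])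
      (by rw [← e₂, h₂]) (by rw [← e₃, h₃]) (by rw [← e₄, h₄]) := by
  subst e₁ e₂ e₃ e₄
  rfl

theorem pr_delta2Sec :
    ((delta2 F G).obj P).pr (delta2Sec P x s₁ s₂ s₃ s₄ h₁ h₂ h₃ h₄) = x :=
  (pr_tmul _ _ _).trans ((pr_tmul _ _ _).trans (pr_tmul _ _ _))

theorem res_delta2Sec (g : V ⟶ U) :
    ((delta2 F G).obj P).res g (delta2Sec P x s₁ s₂ s₃ s₄ h₁ h₂ h₃ h₄) =
      delta2Sec P (g ≫ x) (P.res g s₁) (P.res g s₂) (P.res g s₃) (P.res g s₄)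
        (by simp [h₁]) (by simp [h₂]) (by simp [h₃]) (by simp [h₄]) := by
  exact (res_tmul _ _ _ _).trans (tmul_congr _ ((res_tmul _ _ _ _).trans
    (tmul_congr _ (res_tmul _ _ _ _) rfl)) rfl)

theorem delta2Sec_smul (f₁ f₂ f₃ f₄ : F.obj.obj (op U)) :
    delta2Sec P x (f₁ • s₁) (f₂ • s₂) (f₃ • s₃) (f₄ • s₄) (by simp [h₁]) (by simp [h₂])
      (by simp [h₃]) (by simp [h₄]) =
      (f₁ * f₂⁻¹ * f₃ * f₄⁻¹) • delta2Sec P x s₁ s₂ s₃ s₄ h₁ h₂ h₃ h₄ := by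
  have e₂ : dualSec _ (pullbackSec (m01 G) P x (f₂ • s₂) (by simp [h₂])) =
      f₂⁻¹ • dualSec _ (pullbackSec (m01 G) P x s₂ h₂) := by
    rw [smul_dualSec, inv_inv, smul_pullbackSec]
  have e₄ : dualSec _ (pullbackSec (p01 G) P x (f₄ • s₄) (by simp [h₄])) =
      f₄⁻¹ • dualSec _ (pullbackSec (p01 G) P x s₄ h₄) := by
    rw [smul_dualSec, inv_inv, smul_pullbackSec]
  have h0 : (pullback (p12 G) P).pr (pullbackSec (p12 G) P x s₁ h₁) =
      (dual (pullback (m01 G) P)).pr (dualSec _ (pullbackSec (m01 G) P x s₂ h₂)) := by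
    rw [pr_dualSec, pr_pullbackSec, pr_pullbackSec]
  have k0 := smul_tmul_smul f₁ f₂⁻¹ _ _ h0
  have h1 : (tensor _ _).pr (tmul _ _ h0) =
      (pullback (m12 G) P).pr (pullbackSec (m12 G) P x s₃ h₃) := by
    rw [pr_tmul, pr_pullbackSec, pr_pullbackSec]
  have k1 := smul_tmul_smul (f₁ * f₂⁻¹) f₃ _ _ h1
  exact (tmul_congr _ ((tmul_congr _ ((tmul_congr _ rfl e₂).trans k0) rfl).trans k1) e₄).trans
    (smul_tmul_smul (f₁ * f₂⁻¹ * f₃) f₄⁻¹ (tmul _ _ h1)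
      (dualSec _ (pullbackSec (p01 G) P x s₄ h₄))
      (by rw [pr_tmul, pr_tmul, pr_dualSec, pr_pullbackSec, pr_pullbackSec]))

theorem app_delta2_map {P' : Torsor F (G ⊗ G)} (φ : P ⟶ P') :
    app ((delta2 F G).map φ) (delta2Sec P x s₁ s₂ s₃ s₄ h₁ h₂ h₃ h₄) =
      delta2Sec P' x (app φ s₁) (app φ s₂) (app φ s₃) (app φ s₄) (by simp [h₁]) (by simp [h₂])
        (by simp [h₃]) (by simp [h₄]) := by
  exact (app_tensorMap _ _ _ _ _).trans (tmul_congr _ ((app_tensorMap _ _ _ _ _).trans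
    (tmul_congr _ (app_tensorMap _ _ _ _ _) rfl)) rfl)

end

variable (F G) in
/-- The canonical isomorphism `F_{G³} ≅ δ² F_{G²}`, sending `1` to `1 ⊗ 1^∨ ⊗ 1 ⊗ 1^∨`. -/
def delta2Trivial : trivial F (G ⊗ G ⊗ G) ≅ (delta2 F G).obj (trivial F (G ⊗ G)) :=
  trivialise _
    (fun x => delta2Sec _ x (trivialSec 1 (x ≫ p12 G)) (trivialSec 1 (x ≫ m01 G))
      (trivialSec 1 (x ≫ m12 G)) (trivialSec 1 (x ≫ p01 G)) rfl rfl rfl rfl)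
    (fun x => pr_delta2Sec _ _ _ _ _ _ _ _ _ _)
    (fun {U V} g x => by
      have e : ∀ a : U ⟶ G ⊗ G, (trivial F (G ⊗ G)).res g (trivialSec 1 a) =
          trivialSec 1 (g ≫ a) := fun a => Prod.ext (map_one (F.obj.map g.op).hom) rfl
      refine (res_delta2Sec _ _ _ _ _ _ _ _ _ _ g).trans (delta2Sec_congr _ _ _ _ ?_ ?_ ?_ ?_) <;>
        rw [e, Category.assoc])

/-- Sections of `T` over the points `a`, `b`, `c`, `ab`, `bc`, `abc` of `G`, where `x = (a, b, c)`
is a point of `G³`. -/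
structure Frame (T : Torsor F G) (x : U ⟶ G ⊗ G ⊗ G) where
  a : T.sec U
  b : T.sec U
  c : T.sec U
  ab : T.sec U
  bc : T.sec U
  abc : T.sec U
  ha : T.pr a = x ≫ p01 G ≫ fst G G
  hb : T.pr b = x ≫ p01 G ≫ snd G G
  hc : T.pr c = x ≫ p12 G ≫ snd G G
  hab : T.pr ab = x ≫ p01 G ≫ μ[G]
  hbc : T.pr bc = x ≫ p12 G ≫ μ[G]
  habc : T.pr abc = x ≫ m01 G ≫ μ[G]

namespace Frame

variable {T : Torsor F G} {x : U ⟶ G ⊗ G ⊗ G}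

/-- Restriction of frames. -/
def res (s : Frame T x) (g : V ⟶ U) : Frame T (g ≫ x) where
  a := T.res g s.a
  b := T.res g s.b
  c := T.res g s.c
  ab := T.res g s.ab
  bc := T.res g s.bc
  abc := T.res g s.abc
  ha := by simp [s.ha]
  hb := by simp [s.hb]
  hc := by simp [s.hc]
  hab := by simp [s.hab]
  hbc := by simp [s.hbc]
  habc := by simp [s.habc]

/-- The section
`(c ⊗ bc^∨ ⊗ b) ⊗ (c ⊗ abc^∨ ⊗ ab)^∨ ⊗ (bc ⊗ abc^∨ ⊗ a) ⊗ (b ⊗ ab^∨ ⊗ a)^∨` of `δ² δ¹ T`. -/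
def section₂ (s : Frame T x) : ((delta2 F G).obj ((delta1 F G).obj T)).sec U :=
  delta2Sec _ x
    (delta1Sec T (x ≫ p12 G) s.c s.bc s.b (by simp [s.hc]) (by simp [s.hbc])
      (by simp [s.hb, p12_fst]))
    (delta1Sec T (x ≫ m01 G) s.c s.abc s.ab (by simp [s.hc, m01_snd]) (by simp [s.habc])
      (by simp [s.hab, m01_fst]))
    (delta1Sec T (x ≫ m12 G) s.bc s.abc s.a (by simp [s.hbc, m12_snd])
      (by simp [s.habc, m12_mul]) (by simp [s.ha, m12_fst]))
    (delta1Sec T (x ≫ p01 G) s.b s.ab s.a (by simp [s.hb]) (by simp [s.hab]) (by simp [s.ha]))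
    (pr_delta1Sec _ _ _ _ _ _ _ _) (pr_delta1Sec _ _ _ _ _ _ _ _)
    (pr_delta1Sec _ _ _ _ _ _ _ _) (pr_delta1Sec _ _ _ _ _ _ _ _)

theorem res_section₂ (s : Frame T x) (g : V ⟶ U) :
    ((delta2 F G).obj ((delta1 F G).obj T)).res g s.section₂ = (s.res g).section₂ := by
  refine (res_delta2Sec _ _ _ _ _ _ _ _ _ _ g).trans (delta2Sec_congr _ _ _ _ ?_ ?_ ?_ ?_) <;>
    exact (res_delta1Sec _ _ _ _ _ _ _ _ g).trans
      (delta1Sec_congr _ _ _ (Category.assoc _ _ _).symm rfl rfl rfl)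

theorem scalar_eq_one {A : Type*} [CommGroup A] (a b c ab bc abc : A) :
    c * bc⁻¹ * b * (c * abc⁻¹ * ab)⁻¹ * (bc * abc⁻¹ * a) * (b * ab⁻¹ * a)⁻¹ = 1 := by
  apply Additive.ofMul.injective
  simp only [ofMul_mul, ofMul_inv, ofMul_one]
  abel

/-- The section of `δ² δ¹ T` does not depend on the chosen sections of `T`. -/
theorem section₂_eq (s s' : Frame T x) : s.section₂ = s'.section₂ := by
  obtain ⟨a, b, c, ab, bc, abc, ha, hb, hc, hab, hbc, habc⟩ := s
  obtain ⟨a', b', c', ab', bc', abc', ha', hb', hc', hab', hbc', habc'⟩ := s'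
  obtain ⟨fa, rfl⟩ := T.exists_smul (ha.trans ha'.symm)
  obtain ⟨fb, rfl⟩ := T.exists_smul (hb.trans hb'.symm)
  obtain ⟨fc, rfl⟩ := T.exists_smul (hc.trans hc'.symm)
  obtain ⟨fab, rfl⟩ := T.exists_smul (hab.trans hab'.symm)
  obtain ⟨fbc, rfl⟩ := T.exists_smul (hbc.trans hbc'.symm)
  obtain ⟨fabc, rfl⟩ := T.exists_smul (habc.trans habc'.symm)
  symm
  refine (delta2Sec_congr _ _ _ _
    (delta1Sec_smul T _ c bc b (by simp [hc]) (by simp [hbc]) (by simp [hb, p12_fst]) fc fbc fb)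
    (delta1Sec_smul T _ c abc ab (by simp [hc, m01_snd]) (by simp [habc]) (by simp [hab, m01_fst])
      fc fabc fab)
    (delta1Sec_smul T _ bc abc a (by simp [hbc, m12_snd]) (by simp [habc, m12_mul])
      (by simp [ha, m12_fst]) fbc fabc fa)
    (delta1Sec_smul T _ b ab a (by simp [hb]) (by simp [hab]) (by simp [ha]) fb fab fa)).trans ?_
  refine (delta2Sec_smul _ x _ _ _ _ (pr_delta1Sec ..) (pr_delta1Sec ..) (pr_delta1Sec ..)
    (pr_delta1Sec ..) _ _ _ _).trans ?_
  rw [scalar_eq_one]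
  exact MulAction.one_smul _

end Frame

set_option linter.unusedSectionVars false in
theorem exists_local_frame (T : Torsor F G) (x : U ⟶ G ⊗ G ⊗ G) :
    ∃ R ∈ J U, ∀ ⦃V : C⦄ (g : V ⟶ U), R g → Nonempty (Frame T (g ≫ x)) := by
  obtain ⟨R₁, hR₁, H₁⟩ := T.local_sec (x ≫ p01 G ≫ fst G G)
  obtain ⟨R₂, hR₂, H₂⟩ := T.local_sec (x ≫ p01 G ≫ snd G G)
  obtain ⟨R₃, hR₃, H₃⟩ := T.local_sec (x ≫ p12 G ≫ snd G G)
  obtain ⟨R₄, hR₄, H₄⟩ := T.local_sec (x ≫ p01 G ≫ μ[G])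
  obtain ⟨R₅, hR₅, H₅⟩ := T.local_sec (x ≫ p12 G ≫ μ[G])
  obtain ⟨R₆, hR₆, H₆⟩ := T.local_sec (x ≫ m01 G ≫ μ[G])
  refine ⟨R₁ ⊓ (R₂ ⊓ (R₃ ⊓ (R₄ ⊓ (R₅ ⊓ R₆)))), J.intersection_covering hR₁
    (J.intersection_covering hR₂ (J.intersection_covering hR₃ (J.intersection_covering hR₄
      (J.intersection_covering hR₅ hR₆)))), fun V g hg => ?_⟩
  obtain ⟨a, ha⟩ := H₁ g hg.1
  obtain ⟨b, hb⟩ := H₂ g hg.2.1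
  obtain ⟨c, hc⟩ := H₃ g hg.2.2.1
  obtain ⟨ab, hab⟩ := H₄ g hg.2.2.2.1
  obtain ⟨bc, hbc⟩ := H₅ g hg.2.2.2.2.1
  obtain ⟨abc, habc⟩ := H₆ g hg.2.2.2.2.2
  exact ⟨⟨a, b, c, ab, bc, abc, by simp [ha], by simp [hb], by simp [hc], by simp [hab],
    by simp [hbc], by simp [habc]⟩⟩

theorem existsUnique_kappaSec (T : Torsor F G) (x : U ⟶ G ⊗ G ⊗ G) :
    ∃! k : ((delta2 F G).obj ((delta1 F G).obj T)).sec U,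
      ∀ ⦃V : C⦄ (g : V ⟶ U) (s : Frame T (g ≫ x)),
        ((delta2 F G).obj ((delta1 F G).obj T)).res g k = s.section₂ := by
  obtain ⟨R, hR, H⟩ := exists_local_frame T x
  obtain ⟨k, hk⟩ := glue ((delta2 F G).obj ((delta1 F G).obj T)) hR
    (fun V g k => ∃ s : Frame T (g ≫ x), k = s.section₂)
    (fun V W g h k ⟨s, hs⟩ => by
      subst hs
      rw [Frame.res_section₂]
      have e : h ≫ g ≫ x = (h ≫ g) ≫ x := (Category.assoc _ _ _).symm
      generalize s.res h = s'
      revert s'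
      rw [e]
      exact fun s' => ⟨s', rfl⟩)
    (fun V g k k' _ ⟨s, hs⟩ ⟨s', hs'⟩ => by rw [hs, hs', Frame.section₂_eq s s'])
    (fun V g hg => ⟨_, (H g hg).some, rfl⟩)
  refine ⟨k, fun V g s => ?_, fun k' hk' => sep _ hR fun V g hg => ?_⟩
  · refine sep _ (J.pullback_stable g hR) fun W h hh => ?_
    obtain ⟨s', hs'⟩ := hk (h ≫ g) hh
    rw [res_res, hs', Frame.res_section₂]
    have e : (h ≫ g) ≫ x = h ≫ g ≫ x := Category.assoc _ _ _
    generalize s.res h = s''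
    revert s''
    rw [← e]
    exact fun s'' => Frame.section₂_eq _ _
  · obtain ⟨s, hs⟩ := hk g hg
    rw [hs, hk' g s]

/-- The canonical section of `δ² δ¹ T`. -/
def kappaSec (T : Torsor F G) (x : U ⟶ G ⊗ G ⊗ G) :
    ((delta2 F G).obj ((delta1 F G).obj T)).sec U := (existsUnique_kappaSec T x).choose

theorem kappaSec_spec (T : Torsor F G) (x : U ⟶ G ⊗ G ⊗ G) (g : V ⟶ U) (s : Frame T (g ≫ x)) :
    ((delta2 F G).obj ((delta1 F G).obj T)).res g (kappaSec T x) = s.section₂ :=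
  (existsUnique_kappaSec T x).choose_spec.1 g s

theorem kappaSec_eq (T : Torsor F G) (x : U ⟶ G ⊗ G ⊗ G) (s : Frame T x) :
    kappaSec T x = s.section₂ := by
  have e : 𝟙 U ≫ x = x := Category.id_comp x
  rw [← res_id _ (kappaSec T x), kappaSec_spec T x (𝟙 U) (s.res (𝟙 U)), ← Frame.res_section₂,
    res_id]

theorem res_kappaSec (T : Torsor F G) (x : U ⟶ G ⊗ G ⊗ G) (g : V ⟶ U) :
    ((delta2 F G).obj ((delta1 F G).obj T)).res g (kappaSec T x) = kappaSec T (g ≫ x) := by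
  refine ((existsUnique_kappaSec T (g ≫ x)).unique (fun W h s => ?_)
    (fun W h s => kappaSec_spec T (g ≫ x) h s))
  have e : (h ≫ g) ≫ x = h ≫ g ≫ x := Category.assoc _ _ _
  rw [res_res]
  revert s
  rw [← e]
  exact fun s => kappaSec_spec T x (h ≫ g) s

theorem pr_kappaSec (T : Torsor F G) (x : U ⟶ G ⊗ G ⊗ G) :
    ((delta2 F G).obj ((delta1 F G).obj T)).pr (kappaSec T x) = x := by
  obtain ⟨R, hR, H⟩ := exists_local_frame T x
  refine hom_sep hR fun V g hg => ?_
  rw [← pr_res, res_kappaSec, kappaSec_eq T _ (H g hg).some]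
  exact pr_delta2Sec ..

/-- The canonical trivialisation `κ_T : F_{G³} ≅ δ² δ¹ T`: over a point `(a, b, c)` of `G³` it
sends `1` to
`(t_c ⊗ t_bc^∨ ⊗ t_b) ⊗ (t_c ⊗ t_abc^∨ ⊗ t_ab)^∨ ⊗ (t_bc ⊗ t_abc^∨ ⊗ t_a) ⊗ (t_b ⊗ t_ab^∨ ⊗ t_a)^∨`
for any local sections `t_a`, `t_b`, `t_c`, `t_ab`, `t_bc`, `t_abc` of `T` over the points `a`,
`b`, `c`, `ab`, `bc`, `abc` of `G`. -/
def kappa (T : Torsor F G) :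
    trivial F (G ⊗ G ⊗ G) ≅ (delta2 F G).obj ((delta1 F G).obj T) :=
  trivialise _ (fun x => kappaSec T x) (fun x => pr_kappaSec T x) (fun g x => res_kappaSec T x g)

variable (F G)

/-- An `F`-extension datum on `G`: an `F`-torsor `T` over `G` and a trivialisation
`τ : F_{G²} ≅ δ¹ T` such that `κ_T : F_{G³} ≅ δ² δ¹ T` is the composition of the canonical
isomorphism `F_{G³} ≅ δ² F_{G²}` with `δ² τ`. -/
structure ExtensionDatum where
  T : Torsor F G
  τ : trivial F (G ⊗ G) ≅ (delta1 F G).obj T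
  triangle : (delta2Trivial F G).hom ≫ (delta2 F G).map τ.hom = (kappa T).hom

variable {F G}

namespace ExtensionDatum

/-- An isomorphism `(T, τ) ⟶ (T', τ')` of extension data: an isomorphism `φ : T ≅ T'` of torsors
with `δ¹ φ ∘ τ = τ'`. -/
@[ext] structure Hom (D D' : ExtensionDatum F G) where
  φ : D.T ≅ D'.T
  triangle : D.τ.hom ≫ (delta1 F G).map φ.hom = D'.τ.hom

/-- The groupoid of `F`-extension data on `G`. -/
instance : Groupoid (ExtensionDatum F G) where
  Hom := Hom
  id D := ⟨Iso.refl _, by simp⟩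
  comp α β := ⟨α.φ ≪≫ β.φ, by
    rw [Iso.trans_hom, CategoryTheory.Functor.map_comp, ← Category.assoc, α.triangle, β.triangle]⟩
  inv α := ⟨α.φ.symm, by
    rw [← α.triangle, Category.assoc, ← Functor.map_comp, Iso.symm_hom, Iso.hom_inv_id,
      CategoryTheory.Functor.map_id, Category.comp_id]⟩
  id_comp α := Hom.ext (Iso.refl_trans _)
  comp_id α := Hom.ext (Iso.trans_refl _)
  assoc α β α' := Hom.ext (Iso.trans_assoc _ _ _)
  inv_comp α := Hom.ext (Iso.symm_self_id _)
  comp_inv α := Hom.ext (Iso.self_symm_id _)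

variable (F G) in
/-- The functor sending `(T, τ)` to `T`. -/
def forget : ExtensionDatum F G ⥤ Torsor F G where
  obj D := D.T
  map {D D'} α := (ExtensionDatum.Hom.φ (D := D) (D' := D') α).hom
  map_id _ := rfl
  map_comp _ _ := rfl

end ExtensionDatum

end Delta

/-! ### Central extensions -/

section CentralExtension

variable [CartesianMonoidalCategory C]
variable (F : Sheaf J CommGrpCat.{u + 1}) (G : C) [GrpObj G]

/-- A central extension `1 ⟶ F ⟶ E ⟶ G ⟶ 1` of sheaves of groups; `G` stands for the sheaf of
groups `U ↦ Hom(U, G)`, and surjectivity is surjectivity as a morphism of sheaves. -/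
structure CentralExtension where
  E : Sheaf J GrpCat.{u + 1}
  j : ∀ {U : C}, F.obj.obj (op U) →* E.obj.obj (op U)
  q : ∀ {U : C}, E.obj.obj (op U) →* (U ⟶ G)
  j_map : ∀ {U V : C} (g : V ⟶ U) (f : F.obj.obj (op U)),
    E.obj.map g.op (j f) = j (F.obj.map g.op f)
  q_map : ∀ {U V : C} (g : V ⟶ U) (x : E.obj.obj (op U)), q (E.obj.map g.op x) = g ≫ q x
  j_injective : ∀ {U : C}, Function.Injective (j : F.obj.obj (op U) →* E.obj.obj (op U))
  exact : ∀ {U : C} (x : E.obj.obj (op U)), q x = 1 ↔ ∃ f, j f = x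
  q_locally_surjective : ∀ {U : C} (a : U ⟶ G), ∃ R ∈ J U, ∀ ⦃V : C⦄ (g : V ⟶ U), R g →
    ∃ x : E.obj.obj (op V), q x = g ≫ a
  central : ∀ {U : C} (f : F.obj.obj (op U)) (x : E.obj.obj (op U)), j f * x = x * j f

variable {F G}

namespace CentralExtension

/-- Morphisms of central extensions of `G` by `F`: homomorphisms of sheaves of groups inducing the
identity on `F` and on `G`. -/
@[ext] structure Hom (E E' : CentralExtension F G) where
  hom : E.E ⟶ E'.E
  j_hom : ∀ {U : C} (f : F.obj.obj (op U)), hom.hom.app (op U) (E.j f) = E'.j f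
  q_hom : ∀ {U : C} (x : E.E.obj.obj (op U)), E'.q (hom.hom.app (op U) x) = E.q x

/-- The category of central extensions of `G` by `F`. -/
instance : Category (CentralExtension F G) where
  Hom := Hom
  id E := ⟨𝟙 _, fun _ => rfl, fun _ => rfl⟩
  comp α β := ⟨α.hom ≫ β.hom,
    fun f => (congrArg _ (α.j_hom f)).trans (β.j_hom f),
    fun x => (β.q_hom _).trans (α.q_hom x)⟩

/-- A central extension `E` as an `F`-torsor over `G`, with `f` acting as multiplication by
`j f`. -/
def toTorsor (E : CentralExtension F G) : Torsor F G where
  sheaf := (sheafCompose J (CategoryTheory.forget GrpCat.{u + 1})).obj E.E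
  proj {U} (x : E.E.obj.obj (op U)) := E.q x
  smul {U} f (x : E.E.obj.obj (op U)) := (E.j f * x : E.E.obj.obj (op U))
  proj_map g x := E.q_map g x
  smul_map {U V} g f x := by
    refine (map_mul (E.E.obj.map g.op).hom (E.j f) x).trans ?_
    exact congrArg (fun k : E.E.obj.obj (op V) => k * (E.E.obj.map g.op).hom x) (E.j_map g f)
  proj_smul {U} f x := by
    refine (map_mul E.q (E.j f) x).trans ?_
    exact (congrArg (fun k => k * E.q x) ((E.exact (E.j f)).2 ⟨f, rfl⟩)).trans (_root_.one_mul _)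
  one_smul {U} x := by
    change E.E.obj.obj (op U) at x
    exact (congrArg (· * x) (map_one E.j)).trans (_root_.one_mul x)
  mul_smul {U} f f' x := by
    change E.E.obj.obj (op U) at x
    exact (congrArg (· * x) (map_mul E.j f f')).trans (_root_.mul_assoc _ _ x)
  simply_transitive {U} x y h := by
    change E.E.obj.obj (op U) at x y
    change E.q x = E.q y at h
    obtain ⟨f, hf⟩ := (E.exact (y * x⁻¹)).1 (by rw [map_mul, map_inv, h, mul_inv_cancel])
    refine ⟨f, ?_, fun f' hf' => ?_⟩
    · change E.j f * x = y
      rw [hf, inv_mul_cancel_right]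
    · change E.j f' * x = y at hf'
      refine E.j_injective ?_
      rw [hf, ← hf', mul_inv_cancel_right]
  locally_nonempty a := E.q_locally_surjective a

/-- An element of `E` as a section of the torsor `E` over `G`. -/
def toSec (E : CentralExtension F G) {U : C} (x : E.E.obj.obj (op U)) : E.toTorsor.sec U := x

theorem pr_toSec (E : CentralExtension F G) {U : C} (x : E.E.obj.obj (op U)) :
    E.toTorsor.pr (E.toSec x) = E.q x := rfl

variable (F G) in
/-- The functor sending a central extension to its underlying `F`-torsor over `G`. -/
def torsor : CentralExtension F G ⥤ Torsor F G where
  obj E := E.toTorsor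
  map {E E'} α := Torsor.mkHom (T := E.toTorsor) (T' := E'.toTorsor)
    (fun {U} x => (Hom.hom α).hom.app (op U) x)
    (fun g x => (NatTrans.naturality_apply (Hom.hom α).hom g.op x).symm)
    (fun x => Hom.q_hom α x)
    (fun {U} f x => by
      refine (map_mul ((Hom.hom α).hom.app (op U)).hom (E.j f) x).trans ?_
      exact congrArg (· * ((Hom.hom α).hom.app (op U)).hom x) (Hom.j_hom α f))
  map_id _ := rfl
  map_comp _ _ := rfl

section
variable [J.Subcanonical]

/-- Let `E` be a central extension, `(T, τ)` an extension datum and `φ : E ⟶ T` an isomorphism of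
torsors. Via `φ`, the trivialisation `τ` is the one induced by the multiplication of `E`: over a
point `(q x, q y)` of `G²`, it sends `1` to `y ⊗ (x y)^∨ ⊗ x`. Equivalently, the isomorphism
`p₀^* T ⊗ p₁^* T ≅ m^* T` given by `τ` sends `φ x ⊗ φ y` to `φ (x y)`. -/
def InducesTrivialisation (E : CentralExtension F G) (D : ExtensionDatum F G)
    (φ : E.toTorsor ⟶ D.T) : Prop :=
  ∀ (U : C) (x y : E.E.obj.obj (op U)),
    app D.τ.hom (trivialSec 1 (lift (E.q x) (E.q y))) =
      delta1Sec D.T (lift (E.q x) (E.q y))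
        (app φ (E.toSec y)) (app φ (E.toSec (x * y))) (app φ (E.toSec x))
        (by rw [pr_app, pr_toSec, lift_snd])
        (by rw [pr_app, pr_toSec, map_mul, Hom.mul_def])
        (by rw [pr_app, pr_toSec, lift_fst])

end

end CentralExtension

end CentralExtension

end ExtData

/-! ### Group schemes -/

namespace ExtData

open AlgebraicGeometry

/-- The big fppf site of a scheme `S`. -/
abbrev fppf (S : Scheme.{u}) : GrothendieckTopology (Over S) := Scheme.fppfTopology.over S

/-- The sheaf `F` of abelian groups on the big fppf site of `S` is representable by a scheme that
is fppf and affine over `S`. (Surjectivity onto `S` is automatic because of the unit section, and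
finite presentation follows from local finite presentation for affine morphisms.) -/
def IsRepresentableFppfAffine {S : Scheme.{u}} (F : Sheaf (fppf S) CommGrpCat.{u + 1}) : Prop :=
  ∃ Y : Over S, Nonempty ((underlying F).obj.RepresentableBy Y) ∧
    Flat Y.hom ∧ LocallyOfFinitePresentation Y.hom ∧ IsAffineHom Y.hom

end ExtData

end

noncomputable section

namespace ExtData

open ExtData.Torsor

variable {C : Type (u + 1)} [Category.{u} C] {J : GrothendieckTopology C}
variable {F : Sheaf J CommGrpCat.{u + 1}} {U V : C}

/-! ### Sections of torsors -/

namespace Torsor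

/-! A trivialisation of `δ¹ T` is a composition law on `T` covering that of `G`. Over a point `(g,
h)` the torsor `δ¹ T` is `T_h ⊗ T_{gh}^∨ ⊗ T_g`. Hence for `x`, `y` over `g`, `h` there is exactly
one `z` over `gh` with `τ(1) = y ⊗ z^∨ ⊗ x`, and `z` is declared to be the product `xy`. This
relation is `IsProduct`. By `existsUnique_isProduct` the product exists: locally any section over
`gh` can be rescaled to the right one, and uniqueness lets the local solutions glue. Rescaling also
gives `(f x)(f' y) = f f' (x y)`.

The cocycle condition on `τ` is associativity. The sections `(xy)z` and `x(yz)` lie over the same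
point, so they differ by a section `f` of `F`. Evaluating `δ² τ` and the canonical trivialisation
`κ` over that point shows that they differ by `f⁻¹` (`app_delta2_eq_smul_kappa`). This single
computation serves in both directions: `ExtensionDatum.mul_assoc` and `triangle_of_assoc`.

An associative law that is `F`-equivariant in both variables and covers a group law is automatically
a group law. If `t` lies over `1`, then `t t = f t` for some `f`, and `f⁻¹ t` is the only idempotent
over `1`; it multiplies any section by a scalar `f` with `f² = f`, so it is a unit. Inverses are
found by rescaling in the same way. The map `f ↦ f • 1` embeds `F`, and equivariance in both
variables says that its image is central.

Conversely, in a central extension the section `y ⊗ (xy)^∨ ⊗ x` depends only on the images of `x`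
and `y` in `G`, by centrality (`CentralExtension.mulSec_eq`), so these sections glue to a
trivialisation of `δ¹ E`. Both constructions keep the underlying sheaf, the projection and the
action of `F`. A morphism of torsors respects the trivialisations exactly when it is multiplicative
(`IsProduct.map`, `triangle_of_mul`), which gives full faithfulness. -/

theorem smul_eq_self {X : C} {T : Torsor F X} {f : F.obj.obj (op U)} {t : T.sec U}
    (h : f • t = t) : f = 1 :=
  T.smul_inj (h.trans (MulAction.one_smul t).symm)

variable [J.Subcanonical]

/-- Morphisms out of the trivial torsor are determined by the unit section. -/
theorem trivial_hom_ext {X : C} {P : Torsor F X} {φ ψ : trivial F X ⟶ P}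
    (h : ∀ (U : C) (x : U ⟶ X), app φ (trivialSec 1 x) = app ψ (trivialSec 1 x)) : φ = ψ := by
  refine hom_ext fun U t => ?_
  have e : t = (t.1 : F.obj.obj (op U)) • trivialSec (F := F) 1 t.2 :=
    Prod.ext (_root_.mul_one _).symm rfl
  rw [e, app_smul, app_smul, h]

theorem res_trivialSec_one {X : C} (g : V ⟶ U) (x : U ⟶ X) :
    (trivial F X).res g (trivialSec 1 x) = trivialSec 1 (g ≫ x) :=
  Prod.ext (map_one (F.obj.map g.op).hom) rfl

end Torsor

variable [CartesianMonoidalCategory C] {G : C} [GrpObj G]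

/-! ### Elementary facts on central extensions -/

namespace CentralExtension

variable (E : CentralExtension F G)

/-- Centrality enters here: it lets `j f'` move past `x`, making the multiplication of `E`
equivariant in both variables. -/
theorem j_mul_mul_j_mul {U : C} (f f' : F.obj.obj (op U)) (x y : E.E.obj.obj (op U)) :
    E.j f * x * (E.j f' * y) = E.j (f * f') * (x * y) := by
  rw [map_mul]
  exact Commute.mul_mul_mul_comm (E.central f' x).symm _ _

theorem exists_local_lift {U : C} (a : U ⟶ G ⊗ G) : ∃ R ∈ J U, ∀ ⦃V : C⦄ (g : V ⟶ U), R g →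
    ∃ x y : E.E.obj.obj (op V), g ≫ a = lift (E.q x) (E.q y) := by
  obtain ⟨R, hR, H⟩ := E.q_locally_surjective (a ≫ fst G G)
  obtain ⟨R', hR', H'⟩ := E.q_locally_surjective (a ≫ snd G G)
  refine ⟨_, J.intersection_covering hR hR', fun V g hg => ?_⟩
  obtain ⟨x, hx⟩ := H g hg.1
  obtain ⟨y, hy⟩ := H' g hg.2
  refine ⟨x, y, ?_⟩
  rw [hx, hy]
  ext <;> simp

end CentralExtension

/-! ### The composition law defined by a trivialisation of `δ¹ T` -/

variable [J.Subcanonical]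

/-- The section `y ⊗ z^∨ ⊗ x` of `δ¹ T` over the point `(pr x, pr y)` of `G²`, where `z` lies over
the product of `pr x` and `pr y`. -/
def productSec (T : Torsor F G) (x y z : T.sec U) (h : T.pr z = T.pr x * T.pr y) :
    ((delta1 F G).obj T).sec U :=
  delta1Sec T (lift (T.pr x) (T.pr y)) y z x (by rw [lift_snd]) h (by rw [lift_fst])

theorem pr_productSec (T : Torsor F G) (x y z : T.sec U) (h : T.pr z = T.pr x * T.pr y) :
    ((delta1 F G).obj T).pr (productSec T x y z h) = lift (T.pr x) (T.pr y) :=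
  pr_delta1Sec ..

theorem productSec_congr {T : Torsor F G} {x y z x' y' z' : T.sec U}
    (h : T.pr z = T.pr x * T.pr y) (ex : x = x') (ey : y = y') (ez : z = z') :
    productSec T x y z h = productSec T x' y' z' (by rw [← ex, ← ey, ← ez, h]) := by
  subst ex ey ez
  rfl

theorem res_productSec (T : Torsor F G) (x y z : T.sec U) (h : T.pr z = T.pr x * T.pr y)
    (g : V ⟶ U) : ((delta1 F G).obj T).res g (productSec T x y z h) =
      productSec T (T.res g x) (T.res g y) (T.res g z) (by simp [h, comp_mul]) :=
  (res_delta1Sec ..).trans (delta1Sec_congr _ _ _ (by simp) rfl rfl rfl)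

/-- The factor `z` is dualised, so its scalar enters inverted. Thus `y ⊗ z^∨ ⊗ x` is unchanged
exactly when `fz = fx * fy`, which is the source of both the uniqueness and the bi-equivariance of
products. -/
theorem productSec_smul (T : Torsor F G) (x y z : T.sec U) (h : T.pr z = T.pr x * T.pr y)
    (fx fy fz : F.obj.obj (op U)) :
    productSec T (fx • x) (fy • y) (fz • z) (by simp [h]) =
      (fy * fz⁻¹ * fx) • productSec T x y z h :=
  (delta1Sec_congr _ _ _ (by simp) rfl rfl rfl).trans (delta1Sec_smul T _ y z x _ _ _ fy fz fx)

theorem app_delta1_productSec {T T' : Torsor F G} (φ : T ⟶ T') (x y z : T.sec U)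
    (h : T.pr z = T.pr x * T.pr y) :
    app ((delta1 F G).map φ) (productSec T x y z h) =
      productSec T' (app φ x) (app φ y) (app φ z) (by simp [h]) :=
  (app_delta1_map T _ y z x _ _ _ φ).trans (delta1Sec_congr _ _ _ (by simp) rfl rfl rfl)

/-- The trivialisation `τ` of `δ¹ T` sends `1` over `(pr x, pr y)` to `y ⊗ z^∨ ⊗ x`; that is, `z` is
the product of `x` and `y` in the composition law on `T` defined by `τ`. -/
def IsProduct {T : Torsor F G} (τ : trivial F (G ⊗ G) ⟶ (delta1 F G).obj T) (x y z : T.sec U) :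
    Prop :=
  ∃ h : T.pr z = T.pr x * T.pr y,
    app τ (trivialSec 1 (lift (T.pr x) (T.pr y))) = productSec T x y z h

namespace IsProduct

variable {T : Torsor F G} {τ : trivial F (G ⊗ G) ⟶ (delta1 F G).obj T}

theorem res {x y z : T.sec U} (h : IsProduct τ x y z) (g : V ⟶ U) :
    IsProduct τ (T.res g x) (T.res g y) (T.res g z) := by
  obtain ⟨h, e⟩ := h
  refine ⟨by simp [h, comp_mul], ?_⟩
  rw [← res_productSec T x y z h g, ← e, res_app, res_trivialSec_one]
  simp

theorem smul {x y z : T.sec U} (h : IsProduct τ x y z) (f f' : F.obj.obj (op U)) :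
    IsProduct τ (f • x) (f' • y) ((f * f') • z) := by
  obtain ⟨h, e⟩ := h
  refine ⟨by simp [h], ?_⟩
  rw [productSec_smul T x y z h]
  have : f' * (f * f')⁻¹ * f = 1 := by
    rw [mul_comm f, mul_inv, mul_inv_cancel_left, inv_mul_cancel]
  rw [this, MulAction.one_smul, ← e]
  simp

/-- Both candidates lie over the same point, so `z' = f • z`. This multiplies `y ⊗ z^∨ ⊗ x` by
`f⁻¹`, whereas both sections equal the value of `τ`; hence `f = 1`. -/
theorem unique {x y z z' : T.sec U} (h : IsProduct τ x y z) (h' : IsProduct τ x y z') :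
    z = z' := by
  obtain ⟨h, e⟩ := h
  obtain ⟨h', e'⟩ := h'
  obtain ⟨f, rfl⟩ := T.exists_smul (h.trans h'.symm)
  have k := (productSec_smul T x y z h 1 1 f).symm
  rw [productSec_congr _ (MulAction.one_smul x) (MulAction.one_smul y) rfl, ← e', ← e] at k
  have k' := smul_eq_self k
  rw [_root_.one_mul, _root_.mul_one, inv_eq_one] at k'
  rw [k', MulAction.one_smul]

/-- Transport of structure: a morphism of torsors compatible with the trivialisations is
multiplicative. The converse is `triangle_of_mul`. -/
theorem map {T' : Torsor F G} {τ' : trivial F (G ⊗ G) ⟶ (delta1 F G).obj T'} (φ : T ⟶ T')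
    (hφ : τ ≫ (delta1 F G).map φ = τ') {x y z : T.sec U} (h : IsProduct τ x y z) :
    IsProduct τ' (app φ x) (app φ y) (app φ z) := by
  obtain ⟨h, e⟩ := h
  refine ⟨by simp [h], ?_⟩
  have k := app_delta1_productSec φ x y z h
  rw [← e] at k
  refine Eq.trans ?_ k
  rw [← hφ, app_comp, pr_app, pr_app]

end IsProduct

/-! ### Existence of products; the cocycle condition as associativity -/

section

variable {T : Torsor F G} (τ : trivial F (G ⊗ G) ⟶ (delta1 F G).obj T)

theorem existsUnique_isProduct (x y : T.sec U) : ∃! z, IsProduct τ x y z := by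
  obtain ⟨R, hR, H⟩ := T.local_sec (T.pr x * T.pr y)
  obtain ⟨z, hz⟩ := T.glue hR
    (fun V g z => IsProduct τ (T.res g x) (T.res g y) z)
    (fun V W g h z hz => by
      rw [← res_res, ← res_res]
      exact hz.res h)
    (fun V g z z' _ hz hz' => hz.unique hz')
    (fun V g hg => by
      obtain ⟨z, hz⟩ := H g hg
      have hz' : T.pr z = T.pr (T.res g x) * T.pr (T.res g y) := by
        rw [hz, comp_mul, pr_res, pr_res]
      obtain ⟨f, hf⟩ := exists_smul _
        (t := app τ (trivialSec 1 (lift (T.pr (T.res g x)) (T.pr (T.res g y)))))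
        (t' := productSec T (T.res g x) (T.res g y) z hz')
        (by rw [pr_productSec, pr_app]; rfl)
      -- By `hf`, the value of `τ` times `f` is `y ⊗ z^∨ ⊗ x`. Rescaling `z` by `f` multiplies the
      -- latter by `f⁻¹` and removes the discrepancy.
      refine ⟨f • z, by rw [pr_smul, hz'], ?_⟩
      have k := productSec_smul T _ _ z hz' 1 1 f
      rw [productSec_congr _ (MulAction.one_smul _) (MulAction.one_smul _) rfl, ← hf, smul_smul,
        _root_.one_mul, _root_.mul_one, inv_mul_cancel] at k
      exact (k.trans (MulAction.one_smul _)).symm)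
  have hz0 : T.pr z = T.pr x * T.pr y := hom_sep hR fun V g hg => by
    rw [← pr_res, (hz g hg).1, pr_res, pr_res, comp_mul]
  refine ⟨z, ⟨hz0, sep _ hR fun V g hg => ?_⟩, fun z' hz' => T.sep hR fun V g hg =>
    (hz'.res g).unique (hz g hg)⟩
  rw [res_productSec, ← (hz g hg).2, res_app, res_trivialSec_one]
  simp

/-- Comparison of `δ² τ` with the canonical trivialisation of `δ² δ¹ T`: over the point below
`(x, y, z)` they differ by the associator of the composition law on `T` defined by `τ`. -/
theorem app_delta2_eq_smul_kappa {x y z xy yz w w' : T.sec U} (hxy : IsProduct τ x y xy)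
    (hyz : IsProduct τ y z yz) (hw : IsProduct τ xy z w) (hw' : IsProduct τ x yz w')
    {f : F.obj.obj (op U)} (hf : f • w = w') :
    app ((delta2Trivial F G).hom ≫ (delta2 F G).map τ)
        (trivialSec 1 (lift (T.pr x) (lift (T.pr y) (T.pr z)))) =
      f⁻¹ • app (kappa T).hom (trivialSec 1 (lift (T.pr x) (lift (T.pr y) (T.pr z)))) := by
  set a := lift (T.pr x) (lift (T.pr y) (T.pr z)) with ha
  have e12 : a ≫ p12 G = lift (T.pr y) (T.pr z) := by
    ext <;> simp [ha, p12]
  have e01 : a ≫ p01 G = lift (T.pr x) (T.pr y) := by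
    ext <;> simp [ha, p01]
  have em01 : a ≫ m01 G = lift (T.pr xy) (T.pr z) := by
    refine CartesianMonoidalCategory.hom_ext _ _ ?_ ?_
    · rw [Category.assoc, m01_fst, ← Category.assoc, e01, lift_fst, hxy.1, Hom.mul_def]
    · rw [Category.assoc, m01_snd, ← Category.assoc, e12, lift_snd, lift_snd]
  have em12 : a ≫ m12 G = lift (T.pr x) (T.pr yz) := by
    refine CartesianMonoidalCategory.hom_ext _ _ ?_ ?_
    · rw [Category.assoc, m12_fst, ← Category.assoc, e01, lift_fst, lift_fst]
    · rw [Category.assoc, m12_snd, ← Category.assoc, e12, lift_snd, hyz.1, Hom.mul_def]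
  -- Since `κ` may be computed from any frame, products are taken as its entries, with `w = (xy)z`
  -- over the triple product. The factors of `δ² τ` at `p12`, `m01` and `p01` then agree with those
  -- of the frame, and only the factor at `m12`, which involves `x(yz) = w'`, differs.
  let s : Frame T a :=
    { a := x, b := y, c := z, ab := xy, bc := yz, abc := w
      ha := by rw [← Category.assoc, e01, lift_fst]
      hb := by rw [← Category.assoc, e01, lift_snd]
      hc := by rw [← Category.assoc, e12, lift_snd]
      hab := by rw [← Category.assoc, e01, hxy.1, Hom.mul_def]
      hbc := by rw [← Category.assoc, e12, hyz.1, Hom.mul_def]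
      habc := by rw [← Category.assoc, em01, hw.1, Hom.mul_def] }
  have hk : app (kappa T).hom (trivialSec 1 a) = s.section₂ := by
    refine (app_trivialise ..).trans ?_
    rw [MulAction.one_smul]
    exact kappaSec_eq T a s
  have hd : app (delta2Trivial F G).hom (trivialSec 1 a) =
      delta2Sec _ a (trivialSec 1 (a ≫ p12 G)) (trivialSec 1 (a ≫ m01 G))
        (trivialSec 1 (a ≫ m12 G)) (trivialSec 1 (a ≫ p01 G)) rfl rfl rfl rfl :=
    (app_trivialise ..).trans (MulAction.one_smul _)
  -- The point `b` is left free, subject to an equation, so that the value of `τ` can be read off at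
  -- composites such as `a ≫ p12 G`, which are only propositionally of the form `lift _ _`.
  have key : ∀ {p q r : T.sec U} (h : IsProduct τ p q r) {b : U ⟶ G ⊗ G}
      (hb : b = lift (T.pr p) (T.pr q)), app τ (trivialSec 1 b) =
        delta1Sec T b q r p (by rw [hb, lift_snd]) (by rw [hb, h.1, Hom.mul_def])
          (by rw [hb, lift_fst]) := by
    rintro p q r h _ rfl
    exact h.2
  -- Associativity of `G`, in the form `m12_mul`, puts `w` over the point needed in the factor at
  -- `m12`.
  have hww : T.pr w = a ≫ m12 G ≫ μ := by
    rw [m12_mul, ← Category.assoc, em01, hw.1, Hom.mul_def]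
  have key' : app τ (trivialSec 1 (a ≫ m12 G)) = f⁻¹ •
      delta1Sec T (a ≫ m12 G) yz w x (by rw [em12, lift_snd]) (by rw [hww, Category.assoc])
        (by rw [em12, lift_fst]) := by
    -- The value of `τ` here contains `w' = f • w` where the frame has `w`. This entry is dualised
    -- in `δ¹`, so the exchange costs `f⁻¹`.
    have := delta1Sec_smul T (a ≫ m12 G) yz w x (by rw [em12, lift_snd])
      (by rw [hww, Category.assoc]) (by rw [em12, lift_fst]) 1 f 1
    rw [_root_.one_mul, _root_.mul_one] at this
    rw [← this, key hw' em12]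
    exact delta1Sec_congr _ _ _ rfl (MulAction.one_smul _).symm hf.symm (MulAction.one_smul _).symm
  rw [app_comp, hd, hk]
  -- The factor at `m12` occurs undualised in `δ²`, so the scalar `f⁻¹` passes to the whole section
  -- unchanged.
  have := delta2Sec_smul ((delta1 F G).obj T) a
    (delta1Sec T (a ≫ p12 G) s.c s.bc s.b (by simp [s.hc]) (by simp [s.hbc])
      (by simp [s.hb, p12_fst]))
    (delta1Sec T (a ≫ m01 G) s.c s.abc s.ab (by simp [s.hc, m01_snd]) (by simp [s.habc])
      (by simp [s.hab, m01_fst]))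
    (delta1Sec T (a ≫ m12 G) s.bc s.abc s.a (by simp [s.hbc, m12_snd])
      (by simp [s.habc, m12_mul]) (by simp [s.ha, m12_fst]))
    (delta1Sec T (a ≫ p01 G) s.b s.ab s.a (by simp [s.hb]) (by simp [s.hab]) (by simp [s.ha]))
    (pr_delta1Sec _ _ _ _ _ _ _ _) (pr_delta1Sec _ _ _ _ _ _ _ _)
    (pr_delta1Sec _ _ _ _ _ _ _ _) (pr_delta1Sec _ _ _ _ _ _ _ _) 1 1 f⁻¹ 1
  simp only [_root_.one_mul, _root_.mul_one, inv_one] at this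
  refine ((app_delta2_map ..).trans ?_).trans this
  refine delta2Sec_congr _ _ _ _ ?_ ?_ key' ?_
  · exact (key hyz e12).trans (MulAction.one_smul _).symm
  · exact (key hw em01).trans (MulAction.one_smul _).symm
  · exact (key hxy e01).trans (MulAction.one_smul _).symm

/-- Two morphisms out of a trivial torsor may be compared on unit sections, and locally, where every
point of `G³` lifts to a triple of sections of `T`. The hypothesis supplies a common value `w` of
the two triple products, so the comparison scalar is `1`. -/
theorem triangle_of_assoc
    (hloc : ∀ {U : C} (x y z : T.sec U), ∃ xy yz w : T.sec U, IsProduct τ x y xy ∧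
      IsProduct τ y z yz ∧ IsProduct τ xy z w ∧ IsProduct τ x yz w) :
    (delta2Trivial F G).hom ≫ (delta2 F G).map τ = (kappa T).hom := by
  refine trivial_hom_ext fun U a => ?_
  obtain ⟨R, hR, H⟩ := exists_local_frame T a
  refine sep _ hR fun V g hg => ?_
  obtain ⟨s⟩ := H g hg
  rw [res_app, res_app, res_trivialSec_one]
  have e : g ≫ a = lift (T.pr s.a) (lift (T.pr s.b) (T.pr s.c)) := by
    rw [s.ha, s.hb, s.hc]
    refine CartesianMonoidalCategory.hom_ext _ _ (by simp [p01])
      (CartesianMonoidalCategory.hom_ext _ _ (by simp [p01]) (by simp [p12]))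
  rw [e]
  obtain ⟨xy, yz, w, h1, h2, h3, h4⟩ := hloc s.a s.b s.c
  rw [app_delta2_eq_smul_kappa τ h1 h2 h3 h4 (MulAction.one_smul w), inv_one, MulAction.one_smul]

end

/-! ### The group structure on the torsor of an extension datum -/

namespace ExtensionDatum

variable (D : ExtensionDatum F G)

/-- The composition law on the torsor of an extension datum. -/
def mul (x y : D.T.sec U) : D.T.sec U := (existsUnique_isProduct D.τ.hom x y).choose

theorem isProduct_mul (x y : D.T.sec U) : IsProduct D.τ.hom x y (D.mul x y) :=
  (existsUnique_isProduct D.τ.hom x y).choose_spec.1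

theorem mul_eq {x y z : D.T.sec U} (h : IsProduct D.τ.hom x y z) : D.mul x y = z :=
  (D.isProduct_mul x y).unique h

theorem pr_mul (x y : D.T.sec U) : D.T.pr (D.mul x y) = D.T.pr x * D.T.pr y :=
  (D.isProduct_mul x y).1

theorem res_mul (g : V ⟶ U) (x y : D.T.sec U) :
    D.T.res g (D.mul x y) = D.mul (D.T.res g x) (D.T.res g y) :=
  (D.mul_eq ((D.isProduct_mul x y).res g)).symm

theorem smul_mul_smul (f f' : F.obj.obj (op U)) (x y : D.T.sec U) :
    D.mul (f • x) (f' • y) = (f * f') • D.mul x y :=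
  D.mul_eq ((D.isProduct_mul x y).smul f f')

theorem smul_mul (f : F.obj.obj (op U)) (x y : D.T.sec U) :
    D.mul (f • x) y = f • D.mul x y := by
  simpa using D.smul_mul_smul f 1 x y

theorem mul_smul (f : F.obj.obj (op U)) (x y : D.T.sec U) :
    D.mul x (f • y) = f • D.mul x y := by
  simpa using D.smul_mul_smul 1 f x y

/-- The two bracketings differ by a scalar `f`, and `app_delta2_eq_smul_kappa` turns the cocycle
condition into `κ(1) = f⁻¹ • κ(1)` over the point in question; simple transitivity gives `f = 1`. -/
theorem mul_assoc (x y z : D.T.sec U) : D.mul (D.mul x y) z = D.mul x (D.mul y z) := by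
  obtain ⟨f, hf⟩ := D.T.exists_smul (t := D.mul (D.mul x y) z) (t' := D.mul x (D.mul y z))
    (by simp only [pr_mul, _root_.mul_assoc])
  have := app_delta2_eq_smul_kappa D.τ.hom (D.isProduct_mul x y) (D.isProduct_mul y z)
    (D.isProduct_mul _ z) (D.isProduct_mul x _) hf
  rw [D.triangle] at this
  have h := smul_eq_self this.symm
  rw [inv_eq_one] at h
  rw [← hf, h, MulAction.one_smul]

/-- The composition law has a unique idempotent over each object. -/
theorem existsUnique_idempotent (U : C) :
    ∃! e : D.T.sec U, D.T.pr e = 1 ∧ D.mul e e = e := by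
  have uniq : ∀ {V : C} (e e' : D.T.sec V), D.T.pr e = 1 ∧ D.mul e e = e →
      D.T.pr e' = 1 ∧ D.mul e' e' = e' → e = e' := by
    rintro V e e' ⟨h, k⟩ ⟨h', k'⟩
    obtain ⟨f, rfl⟩ := D.T.exists_smul (h.trans h'.symm)
    rw [smul_mul_smul, k] at k'
    have := D.T.smul_inj k'
    rw [mul_eq_left] at this
    rw [this, MulAction.one_smul]
  obtain ⟨R, hR, H⟩ := D.T.local_sec (1 : U ⟶ G)
  obtain ⟨e, he⟩ := D.T.glue hR
    (fun V g e => D.T.pr e = 1 ∧ D.mul e e = e)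
    (fun V W g h e he => ⟨by rw [pr_res, he.1, comp_one], by rw [← res_mul, he.2]⟩)
    (fun V g e e' _ h h' => uniq e e' h h')
    (fun V g hg => by
      obtain ⟨t, ht⟩ := H g hg
      rw [comp_one] at ht
      obtain ⟨f, hf⟩ := D.T.exists_smul (t := t) (t' := D.mul t t) (by simp [pr_mul, ht])
      -- If `t t = f t`, then `(f⁻¹ t)(f⁻¹ t) = f⁻² f t = f⁻¹ t`.
      refine ⟨f⁻¹ • t, by simp [ht], ?_⟩
      rw [smul_mul_smul, ← hf, smul_smul, inv_mul_cancel_right])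
  refine ⟨e, ⟨hom_sep hR fun V g hg => ?_, D.T.sep hR fun V g hg => ?_⟩, fun e' he' => ?_⟩
  · rw [← pr_res, (he g hg).1, comp_one]
  · rw [res_mul, (he g hg).2]
  · refine D.T.sep hR fun V g hg => uniq _ _ ?_ (he g hg)
    exact ⟨by rw [pr_res, he'.1, comp_one], by rw [← res_mul, he'.2]⟩

variable (U) in
/-- The unit of the composition law. -/
def one : D.T.sec U := (D.existsUnique_idempotent U).choose

theorem pr_one : D.T.pr (D.one U) = 1 := (D.existsUnique_idempotent U).choose_spec.1.1

theorem one_mul_one : D.mul (D.one U) (D.one U) = D.one U :=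
  (D.existsUnique_idempotent U).choose_spec.1.2

theorem one_eq {e : D.T.sec U} (h : D.T.pr e = 1) (h' : D.mul e e = e) : D.one U = e :=
  (D.existsUnique_idempotent U).unique ⟨D.pr_one, D.one_mul_one⟩ ⟨h, h'⟩

theorem res_one (g : V ⟶ U) : D.T.res g (D.one U) = D.one V :=
  (D.one_eq (by rw [pr_res, pr_one, comp_one]) (by rw [← res_mul, one_mul_one])).symm

/-- Multiplication by the idempotent preserves the point of `G`, so it sends `x` to `f • x`.
Applying it twice is the same as applying it once, whence `f² = f` and `f = 1`. -/
theorem one_mul (x : D.T.sec U) : D.mul (D.one U) x = x := by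
  obtain ⟨f, hf⟩ := D.T.exists_smul (t := x) (t' := D.mul (D.one U) x) (by simp [pr_mul, pr_one])
  have h := D.mul_assoc (D.one U) (D.one U) x
  rw [one_mul_one, ← hf, mul_smul, ← hf] at h
  have := smul_eq_self h.symm
  rw [← hf, this, MulAction.one_smul]

theorem mul_one (x : D.T.sec U) : D.mul x (D.one U) = x := by
  obtain ⟨f, hf⟩ := D.T.exists_smul (t := x) (t' := D.mul x (D.one U)) (by simp [pr_mul, pr_one])
  have h := D.mul_assoc x (D.one U) (D.one U)
  rw [one_mul_one, ← hf, smul_mul, ← hf] at h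
  have := smul_eq_self h
  rw [← hf, this, MulAction.one_smul]

theorem exists_smul_one {x : D.T.sec U} (h : D.T.pr x = 1) :
    ∃ f : F.obj.obj (op U), f • D.one U = x :=
  D.T.exists_smul (D.pr_one.trans h.symm)

/-- Together with `mul_smul_one` this gives centrality of `f ↦ f • 1`; alone it shows that
multiplication by the image of `F` recovers the original action on `T`. -/
theorem smul_one_mul (f : F.obj.obj (op U)) (x : D.T.sec U) : D.mul (f • D.one U) x = f • x := by
  rw [smul_mul, one_mul]

theorem mul_smul_one (f : F.obj.obj (op U)) (x : D.T.sec U) : D.mul x (f • D.one U) = f • x := by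
  rw [mul_smul, mul_one]

/-- Locally choose `t` over the inverse point. Then `x t` lies over `1`, so it is `f • 1`, and `f⁻¹
• t` is a right inverse. Uniqueness, needed for gluing, follows because a right inverse must lie
over the inverse point and the law is equivariant. -/
theorem existsUnique_rightInverse (x : D.T.sec U) : ∃! y, D.mul x y = D.one U := by
  have hpr : ∀ {V : C} {x y : D.T.sec V}, D.mul x y = D.one V → D.T.pr y = (D.T.pr x)⁻¹ := by
    intro V x y h
    rw [eq_inv_iff_mul_eq_one, mul_eq_one_comm, ← pr_mul, h, pr_one]
  have uniq : ∀ {V : C} {x y y' : D.T.sec V}, D.mul x y = D.one V → D.mul x y' = D.one V →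
      y = y' := by
    intro V x y y' h h'
    obtain ⟨f, rfl⟩ := D.T.exists_smul ((hpr h).trans (hpr h').symm)
    rw [mul_smul, h] at h'
    rw [smul_eq_self h', MulAction.one_smul]
  obtain ⟨R, hR, H⟩ := D.T.local_sec (D.T.pr x)⁻¹
  obtain ⟨y, hy⟩ := D.T.glue hR (fun V g y => D.mul (D.T.res g x) y = D.one V)
    (fun V W g h y hy => by rw [← res_res, ← res_mul, hy, res_one])
    (fun V g y y' _ h h' => uniq h h')
    (fun V g hg => by
      obtain ⟨t, ht⟩ := H g hg
      obtain ⟨f, hf⟩ := D.exists_smul_one (x := D.mul (D.T.res g x) t)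
        (by rw [pr_mul, ht, pr_res, ← comp_mul, mul_inv_cancel, comp_one])
      exact ⟨f⁻¹ • t, by rw [mul_smul, ← hf, inv_smul_smul]⟩)
  refine ⟨y, D.T.sep hR fun V g hg => ?_, fun y' hy' => D.T.sep hR fun V g hg =>
    uniq (x := D.T.res g x) ?_ (hy g hg)⟩
  · rw [res_mul, hy g hg, res_one]
  · rw [← res_mul, hy', res_one]

/-- The inverse for the composition law. -/
def inv (x : D.T.sec U) : D.T.sec U := (D.existsUnique_rightInverse x).choose

theorem mul_inv (x : D.T.sec U) : D.mul x (D.inv x) = D.one U :=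
  (D.existsUnique_rightInverse x).choose_spec.1

theorem inv_mul (x : D.T.sec U) : D.mul (D.inv x) x = D.one U := by
  -- Writing the unit as the product of `inv x` with its own right inverse reduces the claim to `x =
  -- inv (inv x)`.
  rw [← D.mul_inv (D.inv x)]
  congr 1
  calc x = D.mul x (D.mul (D.inv x) (D.inv (D.inv x))) := by rw [mul_inv, mul_one]
    _ = D.inv (D.inv x) := by rw [← mul_assoc, mul_inv, one_mul]

variable (U) in
/-- The group of sections of the torsor of an extension datum. -/
abbrev group : Group (D.T.sec U) where
  mul := D.mul
  mul_assoc := D.mul_assoc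
  one := D.one U
  one_mul := D.one_mul
  mul_one := D.mul_one
  inv := D.inv
  inv_mul_cancel := D.inv_mul

end ExtensionDatum

attribute [local instance] ExtensionDatum.group

/-! ### The fully faithful functor to central extensions -/

namespace ExtensionDatum

/-- The sheaf of groups defined by an extension datum. -/
def groupSheaf (D : ExtensionDatum F G) : Sheaf J GrpCat.{u + 1} where
  obj :=
    { obj := fun U => GrpCat.of (D.T.sec U.unop)
      map := fun g => GrpCat.ofHom
        { toFun := D.T.res g.unop
          map_one' := D.res_one g.unop
          map_mul' := D.res_mul g.unop }
      map_id := fun U => by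
        ext t
        exact D.T.res_id t
      map_comp := fun g h => by
        ext t
        exact (D.T.res_res g.unop h.unop t).symm }
  property := by
    rw [Presheaf.isSheaf_iff_isSheaf_forget J _ (CategoryTheory.forget GrpCat.{u + 1})]
    exact D.T.sheaf.property

/-- The central extension defined by an extension datum. -/
def toCentralExtension (D : ExtensionDatum F G) : CentralExtension F G where
  E := D.groupSheaf
  j {U} :=
    { toFun := fun f => (f • D.one U : D.T.sec U)
      map_one' := MulAction.one_smul (D.one U)
      map_mul' := fun f f' => by
        refine Eq.trans ?_ (D.smul_mul_smul f f' (D.one U) (D.one U)).symm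
        rw [one_mul_one] }
  q {U} :=
    { toFun := fun x => D.T.pr (U := U) x
      map_one' := D.pr_one
      map_mul' := D.pr_mul }
  j_map {U V} g f := by
    refine (D.T.res_smul g f (D.one U)).trans ?_
    rw [res_one]
    rfl
  q_map g x := D.T.pr_res g x
  j_injective {U} f f' h := D.T.smul_inj (t := D.one U) h
  exact {U} x := by
    refine ⟨fun h => D.exists_smul_one h, ?_⟩
    rintro ⟨f, rfl⟩
    exact (D.T.pr_smul f (D.one U)).trans D.pr_one
  q_locally_surjective a := D.T.local_sec a
  central {U} f x := (D.smul_one_mul f x).trans (D.mul_smul_one f x).symm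

theorem app_mul {D D' : ExtensionDatum F G} (α : D ⟶ D') (x y : D.T.sec U) :
    app (Hom.φ α).hom (D.mul x y) =
      D'.mul (app (Hom.φ α).hom x) (app (Hom.φ α).hom y) :=
  (D'.mul_eq ((D.isProduct_mul x y).map (Hom.φ α).hom (Hom.triangle α))).symm

/-- The unit is characterised as the idempotent over `1`, and multiplicative maps over `G` preserve
this property. -/
theorem app_one {D D' : ExtensionDatum F G} (α : D ⟶ D') :
    app (Hom.φ α).hom (D.one U) = D'.one U :=
  (D'.one_eq (by rw [pr_app, pr_one]) (by rw [← app_mul, one_mul_one])).symm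

/-- The morphism of central extensions defined by a morphism of extension data. -/
def toCentralExtensionMap {D D' : ExtensionDatum F G} (α : D ⟶ D') :
    D.toCentralExtension ⟶ D'.toCentralExtension :=
  CentralExtension.Hom.mk (E := D.toCentralExtension) (E' := D'.toCentralExtension)
    ⟨{ app := fun U => GrpCat.ofHom
        { toFun := fun x => app (Hom.φ α).hom (U := U.unop) x
          map_one' := app_one α
          map_mul' := app_mul α }
       naturality := fun U V g => by
        ext t
        exact (res_app (Hom.φ α).hom g.unop t).symm }⟩
    (fun {U} f => (app_smul (Hom.φ α).hom f (D.one U)).trans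
      (congrArg (fun e : D'.T.sec U => f • e) (app_one α)))
    (fun x => pr_app (Hom.φ α).hom x)

variable (F G) in
/-- The functor from extension data to central extensions. -/
def centralExtensionFunctor : ExtensionDatum F G ⥤ CentralExtension F G where
  obj D := D.toCentralExtension
  map α := toCentralExtensionMap α
  map_id _ := rfl
  map_comp _ _ := rfl

/-- The identity map, as an isomorphism from the torsor underlying the central extension of an
extension datum to the torsor of the datum. -/
def toTorsorHom (D : ExtensionDatum F G) : D.toCentralExtension.toTorsor ⟶ D.T :=
  mkHom (T := D.toCentralExtension.toTorsor) (T' := D.T) (fun x => x) (fun _ _ => rfl)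
    (fun _ => rfl) (fun f x => D.smul_one_mul f x)

/-- The product was defined by the very identity required here. -/
theorem inducesTrivialisation_toTorsorHom (D : ExtensionDatum F G) :
    D.toCentralExtension.InducesTrivialisation D D.toTorsorHom :=
  fun _ x y => (D.isProduct_mul x y).2

variable (F G) in
/-- The torsor underlying the central extension of an extension datum is the given one. -/
def centralExtensionFunctorCompTorsor :
    centralExtensionFunctor F G ⋙ CentralExtension.torsor F G ≅ ExtensionDatum.forget F G :=
  NatIso.ofComponents
    (fun D => @asIso _ _ _ _ D.toTorsorHom (isIso_hom D.toTorsorHom))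
    (fun _ => rfl)

/-- A point of `G²` lifts locally to a pair `(x, y)` of sections, and there the value of each
trivialisation is expressed through the product of the pair. Multiplicativity of `φ` therefore
forces compatibility; this is what makes the functor full. -/
theorem triangle_of_mul {D D' : ExtensionDatum F G} (φ : D.T ⟶ D'.T)
    (h : ∀ {U : C} (x y : D.T.sec U), app φ (D.mul x y) = D'.mul (app φ x) (app φ y)) :
    D.τ.hom ≫ (delta1 F G).map φ = D'.τ.hom := by
  refine trivial_hom_ext fun U a => ?_
  obtain ⟨R, hR, H⟩ := D.T.local_sec (a ≫ fst G G)
  obtain ⟨R', hR', H'⟩ := D.T.local_sec (a ≫ snd G G)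
  refine sep _ (J.intersection_covering hR hR') fun V g hg => ?_
  obtain ⟨x, hx⟩ := H g hg.1
  obtain ⟨y, hy⟩ := H' g hg.2
  have e : g ≫ a = lift (D.T.pr x) (D.T.pr y) := by
    rw [hx, hy]
    ext <;> simp
  rw [res_app, res_app, res_trivialSec_one, e, app_comp, (D.isProduct_mul x y).2,
    app_delta1_productSec, productSec_congr _ rfl rfl (h x y), ← (D'.isProduct_mul _ _).2,
    pr_app, pr_app]

instance : (centralExtensionFunctor F G).Faithful where
  map_injective {D D'} α β h := by
    refine Hom.ext (Iso.ext (hom_ext fun U t => ?_))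
    exact ConcreteCategory.congr_hom
      (congrArg (fun k => (CentralExtension.Hom.hom k).hom.app (op U)) h) t

instance : (centralExtensionFunctor F G).Full where
  map_surjective {D D'} β := by
    let φ : D.T ⟶ D'.T := mkHom (T := D.T) (T' := D'.T)
      (fun {U} x => ((CentralExtension.Hom.hom β).hom.app (op U)).hom x)
      (fun g x => (NatTrans.naturality_apply (CentralExtension.Hom.hom β).hom g.op x).symm)
      (fun x => CentralExtension.Hom.q_hom β x)
      (fun {U} f x => by
        -- Equivariance of `β` is not given but follows: `f • x` is the product of `f • 1` and `x`,
        -- and `β` is a homomorphism compatible with `j`.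
        refine Eq.trans (congrArg ((CentralExtension.Hom.hom β).hom.app (op U)).hom
          (D.smul_one_mul f x).symm) ?_
        refine (map_mul ((CentralExtension.Hom.hom β).hom.app (op U)).hom _ _).trans ?_
        refine Eq.trans ?_ (D'.smul_one_mul f _)
        exact congrArg (fun e : D'.T.sec U => D'.mul e _) (CentralExtension.Hom.j_hom β f))
    have := isIso_hom φ
    refine ⟨Hom.mk (D := D) (D' := D') (asIso φ) (triangle_of_mul φ fun {U} x y => ?_), rfl⟩
    exact map_mul ((CentralExtension.Hom.hom β).hom.app (op U)).hom x y

end ExtensionDatum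

/-! ### From central extensions to extension data -/

namespace CentralExtension

variable (E : CentralExtension F G)

/-- The section `y ⊗ (x y)^∨ ⊗ x` of `δ¹ E`. -/
def mulSec {U : C} (x y : E.E.obj.obj (op U)) : ((delta1 F G).obj E.toTorsor).sec U :=
  productSec E.toTorsor (E.toSec x) (E.toSec y) (E.toSec (x * y)) (map_mul E.q x y)

/-- Replacing `x`, `y` by `j f * x`, `j f' * y` multiplies `x * y` by `j (f * f')`, thanks to
centrality, and the scalars cancel in `y ⊗ (x y)^∨ ⊗ x`. -/
theorem mulSec_eq {U : C} {x y x' y' : E.E.obj.obj (op U)} (hx : E.q x = E.q x')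
    (hy : E.q y = E.q y') : E.mulSec x y = E.mulSec x' y' := by
  obtain ⟨f, rfl⟩ := E.toTorsor.exists_smul (t := E.toSec x) (t' := E.toSec x') hx
  obtain ⟨f', rfl⟩ := E.toTorsor.exists_smul (t := E.toSec y) (t' := E.toSec y') hy
  have k := productSec_smul E.toTorsor (E.toSec x) (E.toSec y) (E.toSec (x * y))
    (map_mul E.q x y) f f' (f * f')
  have e : f' * (f * f')⁻¹ * f = 1 := by
    rw [mul_comm f, mul_inv, mul_inv_cancel_left, inv_mul_cancel]
  rw [e, MulAction.one_smul] at k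
  exact k.symm.trans (productSec_congr _ rfl rfl (E.j_mul_mul_j_mul f f' x y).symm)

theorem res_mulSec {U V : C} (g : V ⟶ U) (x y : E.E.obj.obj (op U)) :
    ((delta1 F G).obj E.toTorsor).res g (E.mulSec x y) =
      E.mulSec (E.E.obj.map g.op x) (E.E.obj.map g.op y) :=
  (res_productSec ..).trans (productSec_congr _ rfl rfl (map_mul (E.E.obj.map g.op).hom x y))

theorem pr_mulSec {U : C} (x y : E.E.obj.obj (op U)) :
    ((delta1 F G).obj E.toTorsor).pr (E.mulSec x y) = lift (E.q x) (E.q y) :=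
  pr_productSec ..

/-- A point of `G²` need lift to `E` only locally. Independence of the lifts (`mulSec_eq`) makes the
local sections `y ⊗ (x y)^∨ ⊗ x` agree on overlaps, so they glue. -/
theorem existsUnique_trivialisingSec {U : C} (a : U ⟶ G ⊗ G) :
    ∃! s : ((delta1 F G).obj E.toTorsor).sec U,
      ∀ ⦃V : C⦄ (g : V ⟶ U) (x y : E.E.obj.obj (op V)), g ≫ a = lift (E.q x) (E.q y) →
        ((delta1 F G).obj E.toTorsor).res g s = E.mulSec x y := by
  have eq : ∀ {V : C} {x y x' y' : E.E.obj.obj (op V)},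
      lift (E.q x) (E.q y) = lift (E.q x') (E.q y') → E.mulSec x y = E.mulSec x' y' := by
    intro V x y x' y' h
    exact E.mulSec_eq (by simpa using congrArg (· ≫ fst G G) h)
      (by simpa using congrArg (· ≫ snd G G) h)
  have hmap : ∀ {V W : C} {g : V ⟶ U} (h : W ⟶ V) {x y : E.E.obj.obj (op V)},
      g ≫ a = lift (E.q x) (E.q y) →
      (h ≫ g) ≫ a = lift (E.q (E.E.obj.map h.op x)) (E.q (E.E.obj.map h.op y)) := by
    intro V W g h x y e
    rw [Category.assoc, e, E.q_map, E.q_map, comp_lift]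
  obtain ⟨R, hR, H⟩ := E.exists_local_lift a
  obtain ⟨s, hs⟩ := glue ((delta1 F G).obj E.toTorsor) hR
    (fun V g s => ∃ x y : E.E.obj.obj (op V), g ≫ a = lift (E.q x) (E.q y) ∧ s = E.mulSec x y)
    (by
      rintro V W g h s ⟨x, y, e, rfl⟩
      exact ⟨_, _, hmap h e, E.res_mulSec h x y⟩)
    (by
      rintro V g s s' - ⟨x, y, e, rfl⟩ ⟨x', y', e', rfl⟩
      exact eq (e.symm.trans e'))
    (fun V g hg => by
      obtain ⟨x, y, e⟩ := H g hg
      exact ⟨_, x, y, e, rfl⟩)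
  refine ⟨s, fun V g x y e => sep _ (J.pullback_stable g hR) fun W h hh => ?_,
    fun s' hs' => sep _ hR fun V g hg => ?_⟩
  · obtain ⟨x', y', e', k⟩ := hs (h ≫ g) hh
    rw [res_res, k, res_mulSec]
    exact eq (e'.symm.trans (hmap h e))
  · obtain ⟨x, y, e, k⟩ := hs g hg
    rw [k, hs' g x y e]

/-- The section of `δ¹ E` over a point of `G²` defined by the multiplication of `E`. -/
def trivialisingSec {U : C} (a : U ⟶ G ⊗ G) : ((delta1 F G).obj E.toTorsor).sec U :=
  (E.existsUnique_trivialisingSec a).choose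

theorem res_trivialisingSec_eq {U V : C} (a : U ⟶ G ⊗ G) (g : V ⟶ U) (x y : E.E.obj.obj (op V))
    (h : g ≫ a = lift (E.q x) (E.q y)) :
    ((delta1 F G).obj E.toTorsor).res g (E.trivialisingSec a) = E.mulSec x y :=
  (E.existsUnique_trivialisingSec a).choose_spec.1 g x y h

theorem trivialisingSec_lift {U : C} (x y : E.E.obj.obj (op U)) :
    E.trivialisingSec (lift (E.q x) (E.q y)) = E.mulSec x y := by
  rw [← E.res_trivialisingSec_eq _ (𝟙 U) x y (Category.id_comp _), res_id]

theorem res_trivialisingSec {U V : C} (g : V ⟶ U) (a : U ⟶ G ⊗ G) :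
    ((delta1 F G).obj E.toTorsor).res g (E.trivialisingSec a) = E.trivialisingSec (g ≫ a) := by
  refine (E.existsUnique_trivialisingSec (g ≫ a)).unique (fun W h x y e => ?_)
    (fun W h x y e => E.res_trivialisingSec_eq _ h x y e)
  rw [res_res]
  exact E.res_trivialisingSec_eq a _ x y (by rw [Category.assoc, e])

theorem pr_trivialisingSec {U : C} (a : U ⟶ G ⊗ G) :
    ((delta1 F G).obj E.toTorsor).pr (E.trivialisingSec a) = a := by
  obtain ⟨R, hR, H⟩ := E.exists_local_lift a
  refine hom_sep hR fun V g hg => ?_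
  obtain ⟨x, y, e⟩ := H g hg
  rw [← pr_res, res_trivialisingSec, e, trivialisingSec_lift, pr_mulSec]

/-- The trivialisation of `δ¹ E` defined by the multiplication of `E`. -/
def trivialisation : trivial F (G ⊗ G) ≅ (delta1 F G).obj E.toTorsor :=
  trivialise _ (fun a => E.trivialisingSec a) (fun a => E.pr_trivialisingSec a)
    (fun g a => E.res_trivialisingSec g a)

/-- The composition law read off from the trivialisation is the original multiplication of `E`. This
yields both the cocycle condition and the recovery of `E` from its datum. -/
theorem isProduct_trivialisation {U : C} (x y : E.E.obj.obj (op U)) :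
    IsProduct E.trivialisation.hom (E.toSec x) (E.toSec y) (E.toSec (x * y)) :=
  ⟨map_mul E.q x y, (app_trivialise ..).trans
    ((MulAction.one_smul _).trans (E.trivialisingSec_lift x y))⟩

/-- The extension datum defined by a central extension. -/
def toExtensionDatum : ExtensionDatum F G where
  T := E.toTorsor
  τ := E.trivialisation
  triangle := triangle_of_assoc _ fun {U} x y z => by
    change E.E.obj.obj (op U) at x y z
    -- The common value of the two bracketings is `x * y * z`; associativity of `E` identifies it
    -- with the product of `x` and `y * z`.
    refine ⟨_, _, _, E.isProduct_trivialisation x y, E.isProduct_trivialisation y z,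
      E.isProduct_trivialisation (x * y) z, ?_⟩
    rw [_root_.mul_assoc]
    exact E.isProduct_trivialisation x (y * z)

theorem toExtensionDatum_mul {U : C} (x y : E.E.obj.obj (op U)) :
    E.toExtensionDatum.mul (E.toSec x) (E.toSec y) = E.toSec (x * y) :=
  E.toExtensionDatum.mul_eq (E.isProduct_trivialisation x y)

theorem toExtensionDatum_one (U : C) : E.toExtensionDatum.one U = E.toSec 1 := by
  refine E.toExtensionDatum.one_eq (e := E.toSec 1) (map_one E.q) ?_
  exact (E.toExtensionDatum_mul 1 1).trans (congrArg E.toSec (_root_.mul_one 1))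

theorem toExtensionDatum_smul_one {U : C} (f : F.obj.obj (op U)) :
    (f • E.toExtensionDatum.one U : E.toExtensionDatum.T.sec U) = E.toSec (E.j f) := by
  rw [toExtensionDatum_one]
  -- The action of `f` on `E` is left multiplication by `j f`, so the left side is `j f * 1` by
  -- definition.
  exact _root_.mul_one (E.j f)

/-- A central extension is recovered from its extension datum. -/
def toExtensionDatumIso : E.toExtensionDatum.toCentralExtension ≅ E where
  hom := Hom.mk (E := E.toExtensionDatum.toCentralExtension) (E' := E)
    ⟨{ app := fun U => GrpCat.ofHom
        { toFun := fun x => x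
          map_one' := E.toExtensionDatum_one U.unop
          map_mul' := fun x y => E.toExtensionDatum_mul x y }
       naturality := fun _ _ _ => rfl }⟩
    (fun f => E.toExtensionDatum_smul_one f)
    (fun _ => rfl)
  inv := Hom.mk (E := E) (E' := E.toExtensionDatum.toCentralExtension)
    ⟨{ app := fun U => GrpCat.ofHom
        { toFun := fun x => x
          map_one' := (E.toExtensionDatum_one U.unop).symm
          map_mul' := fun x y => (E.toExtensionDatum_mul x y).symm }
       naturality := fun _ _ _ => rfl }⟩
    (fun f => (E.toExtensionDatum_smul_one f).symm)
    (fun _ => rfl)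
  hom_inv_id := rfl
  inv_hom_id := rfl

end CentralExtension

/-! ### The equivalence -/

instance : (ExtensionDatum.centralExtensionFunctor F G).EssSurj where
  mem_essImage E := ⟨E.toExtensionDatum, ⟨E.toExtensionDatumIso⟩⟩

instance : (ExtensionDatum.centralExtensionFunctor F G).IsEquivalence where

end ExtData

end

theorem theorem1 (S : AlgebraicGeometry.Scheme.{u}) (G : Over S) [GrpObj G]
    (F : Sheaf (ExtData.fppf S) CommGrpCat.{u + 1}) (hF : ExtData.IsRepresentableFppfAffine F) :
    ∃ (e : ExtData.ExtensionDatum F G ≌ ExtData.CentralExtension F G)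
      (i : e.functor ⋙ ExtData.CentralExtension.torsor F G ≅ ExtData.ExtensionDatum.forget F G),
      ∀ D : ExtData.ExtensionDatum F G,
        (e.functor.obj D).InducesTrivialisation D (i.hom.app D) :=
  ⟨(ExtData.ExtensionDatum.centralExtensionFunctor F G).asEquivalence,
    ExtData.ExtensionDatum.centralExtensionFunctorCompTorsor F G,
    fun D => D.inducesTrivialisation_toTorsorHom⟩
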